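/- Let $d\ge 1$, let $\mathcal S(\mathbb R^d)$ be the (complex-valued) Schwartz class, and write $\widehat f(\xi)=\int_{\mathbb R^d} f(x)e^{-2\pi i x\cdot\xi}\,dx$, extended to the tempered distributions $\mathcal S'(\mathbb R^d)$. Fix $\psi\in\mathcal S(\mathbb R^d)$ with $\operatorname{supp}\psi\subset[-1,1]^d$ and $\sum_{k\in\mathbb Z^d}\psi(\xi-k)\equiv 1$. For $j\in\mathbb Z$, $k\in\mathbb Z^d$ put $\psi_{j,k}(\xi)=\psi(2^{-j}\xi-k)$ and $\psi_{j,k}(D)f=\mathcal F^{-1}(\psi_{j,k}\widehat f)$. The $L^p$ norm of a tempered distribution that is not given by an $L^p$ function is $\infty$. For $1\le p,q,r<\infty$ and weights $w=\{w_j\}_{j\in\mathbb Z}$, $w_j\ge 0$, let $\mathfrak M^{p,q,r}_{w}(\mathbb R^d)$ be the space of all $f\in\mathcal S'(\mathbb R^d)$ with $$\|f\|_{\mathfrak M^{p,q,r}_{w}}=\Big(\sum_{j\in\mathbb Z}w_j^r\Big(\sum_{k\in\mathbb Z^d}\|\psi_{j,k}(D)f\|_{L^p}^q\Big)^{r/q}\Big)^{1/r}<\infty,$$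 and write $\mathfrak M^{p,q}_{w}=\mathfrak M^{p,q,q}_{w}$. For $1\le p,q<\infty$ let $\mathcal F X_{p,q}$ be the space of all $f\in\mathcal S'(\mathbb R^d)$ with $$\|f\|_{\mathcal F X_{p,q}}=\|\widehat f\|_{X_{p,q}}<\infty,\qquad \|u\|_{X_{p,q}}=\Big(\sum_{j\in\mathbb Z}2^{jd\frac{p-2}{2p}q}\sum_{k\in\mathbb Z^d}\|\psi_{j,k}u\|_{L^p}^q\Big)^{1/q}.$$ For $2<p<\infty$ let $\frac1p+\frac1{p'}=1$ and let $w(p)=\{w_j\}_{j\in\mathbb Z}$ with $w_j=2^{jd\frac{p'-2}{2p'}}$. 1. For $2<p<\infty$ and $1\le q<\infty$, every $f\in\mathcal S'(\mathbb R^d)$ satisfies $\|f\|_{\mathfrak M^{p,q}_{w(p)}}\le\|f\|_{\mathcal F X_{p',q}}$ (in $[0,\infty]$). In particular $\mathcal F X_{p',q}\subset\mathfrak M^{p,q}_{w(p)}$. 2. For $2<p,q<\infty$ there is a constant $C$, depending only on $d,\psi,p,q$, such that $\|f\|_{\mathcal F X_{p',q}}\le C\|f\|_{L^2}$ and $\|f\|_{\mathfrak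 M^{p,q}_{w(p)}}\le C\|f\|_{L^2}$ for all $f\in L^2(\mathbb R^d)$. In particular $L^2(\mathbb R^d)\subset\mathfrak M^{p,q}_{w(p)}(\mathbb R^d)$. 3. For $2<p,q<\infty$ the embedding $L^2(\mathbb R^d)\subset\mathfrak M^{p,q}_{w(p)}(\mathbb R^d)$ is strict. More precisely, the function $g(\xi)=|\xi|^{-d/2}\,\big|\ln|\xi|\big|^{-1/2}\,\mathbf 1_{(0,1/2)^d}(\xi)$ is integrable, and the tempered distribution $f=\mathcal F^{-1}g$ belongs to $\mathfrak M^{p,q}_{w(p)}(\mathbb R^d)\setminus L^2(\mathbb R^d)$. -/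

import Mathlib

open MeasureTheory
open scoped NNReal ENNReal SchwartzMap FourierTransform

namespace ScaledModulation

/-- `ψ` is supported in `[-1, 1]^d` and its integer translates sum to `1`. -/
def IsUniformWindow {d : ℕ} (ψ : 𝓢(EuclideanSpace ℝ (Fin d), ℂ)) : Prop :=
  tsupport ψ ⊆ {ξ | ∀ i, ξ i ∈ Set.Icc (-1 : ℝ) 1} ∧
    ∀ ξ, HasSum (fun k : Fin d → ℤ => ψ (ξ - WithLp.toLp 2 (fun i => (k i : ℝ)))) 1

/-- The multiplier `ψ_{j,k}(ξ) = ψ(2^{-j} ξ - k)`. -/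
noncomputable def psiJK {d : ℕ} (ψ : 𝓢(EuclideanSpace ℝ (Fin d), ℂ)) (j : ℤ) (k : Fin d → ℤ)
    (ξ : EuclideanSpace ℝ (Fin d)) : ℂ :=
  ψ ((2 : ℝ) ^ (-j) • ξ - WithLp.toLp 2 (fun i => (k i : ℝ)))

/-- Multiplication by `ψ_{j,k}` and the Fourier multiplier with symbol `ψ_{j,k}` are thus
meaningful on tempered distributions. -/
theorem hasTemperateGrowth_psiJK {d : ℕ} (ψ : 𝓢(EuclideanSpace ℝ (Fin d), ℂ)) (j : ℤ)
    (k : Fin d → ℤ) : (psiJK ψ j k).HasTemperateGrowth := by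
  have h : Function.HasTemperateGrowth (fun ξ : EuclideanSpace ℝ (Fin d) =>
      (2 : ℝ) ^ (-j) • ξ - WithLp.toLp 2 (fun i => (k i : ℝ))) := by
    fun_prop
  exact ψ.hasTemperateGrowth.comp h

/-- `‖u‖_{L^p}` for a tempered distribution `u`: the `L^p` norm of the (a.e. unique) function in
`L^p` that represents `u`, and `∞` if there is none. -/
noncomputable def distLpNorm {d : ℕ} (p : ℝ) (u : 𝓢'(EuclideanSpace ℝ (Fin d), ℂ)) : ℝ≥0∞ :=
  ⨅ (g : EuclideanSpace ℝ (Fin d) → ℂ) (_ : MemLp g (ENNReal.ofReal p) volume)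
    (_ : ∀ φ : 𝓢(EuclideanSpace ℝ (Fin d), ℂ), u φ = ∫ x, φ x * g x),
    eLpNorm g (ENNReal.ofReal p) volume

/-- The norm of the scaled modulation space `M^{p,q}_{[j]}`:
`‖ ‖ψ_{j,k}(D) f‖_{L^p_x} ‖_{ℓ^q_k}`. -/
noncomputable def scaledModNorm {d : ℕ} (ψ : 𝓢(EuclideanSpace ℝ (Fin d), ℂ)) (p q : ℝ) (j : ℤ)
    (f : 𝓢'(EuclideanSpace ℝ (Fin d), ℂ)) : ℝ≥0∞ :=
  (∑' k : Fin d → ℤ,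
    distLpNorm p (TemperedDistribution.fourierMultiplierCLM ℂ (psiJK ψ j k) f) ^ q) ^ (1 / q)

/-- The norm of `𝔐^{p,q,r}_w`. -/
noncomputable def modNorm {d : ℕ} (ψ : 𝓢(EuclideanSpace ℝ (Fin d), ℂ)) (w : ℤ → ℝ≥0)
    (p q r : ℝ) (f : 𝓢'(EuclideanSpace ℝ (Fin d), ℂ)) : ℝ≥0∞ :=
  (∑' j : ℤ, (w j : ℝ≥0∞) ^ r * scaledModNorm ψ p q j f ^ r) ^ (1 / r)

/-- The space `𝔐^{p,q,r}_w` of tempered distributions. -/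
def modSpace {d : ℕ} (ψ : 𝓢(EuclideanSpace ℝ (Fin d), ℂ)) (w : ℤ → ℝ≥0) (p q r : ℝ) :
    Set 𝓢'(EuclideanSpace ℝ (Fin d), ℂ) :=
  {f | modNorm ψ w p q r f < ∞}

/-- The vector weight `w(p)`, `w_j = 2^{j d (p' - 2) / (2 p')}`, where `1/p + 1/p' = 1`. -/
noncomputable def weight (d : ℕ) (p : ℝ) (j : ℤ) : ℝ≥0 :=
  (2 : ℝ≥0) ^ ((j : ℝ) * d * ((p.conjExponent - 2) / (2 * p.conjExponent)))

/-- The norm of `X_{p,q}`. -/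
noncomputable def xNorm {d : ℕ} (ψ : 𝓢(EuclideanSpace ℝ (Fin d), ℂ)) (p q : ℝ)
    (u : 𝓢'(EuclideanSpace ℝ (Fin d), ℂ)) : ℝ≥0∞ :=
  (∑' j : ℤ, (2 : ℝ≥0∞) ^ ((j : ℝ) * d * ((p - 2) / (2 * p)) * q) *
    ∑' k : Fin d → ℤ,
      distLpNorm p (TemperedDistribution.smulLeftCLM ℂ (psiJK ψ j k) u) ^ q) ^ (1 / q)

/-- The norm of `ℱX_{p,q}`: `‖f‖_{ℱX_{p,q}} = ‖𝓕 f‖_{X_{p,q}}`. -/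
noncomputable def fxNorm {d : ℕ} (ψ : 𝓢(EuclideanSpace ℝ (Fin d), ℂ)) (p q : ℝ)
    (f : 𝓢'(EuclideanSpace ℝ (Fin d), ℂ)) : ℝ≥0∞ :=
  xNorm ψ p q (𝓕 f)

/-- The space `ℱX_{p,q}` of tempered distributions. -/
def fxSpace {d : ℕ} (ψ : 𝓢(EuclideanSpace ℝ (Fin d), ℂ)) (p q : ℝ) :
    Set 𝓢'(EuclideanSpace ℝ (Fin d), ℂ) :=
  {f | fxNorm ψ p q f < ∞}

/-- `L^2(ℝ^d)` as a set of tempered distributions. -/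
def l2Space (d : ℕ) : Set 𝓢'(EuclideanSpace ℝ (Fin d), ℂ) :=
  Set.range (fun h : Lp ℂ 2 (volume : Measure (EuclideanSpace ℝ (Fin d))) =>
    (h : 𝓢'(EuclideanSpace ℝ (Fin d), ℂ)))

/-- `g(ξ) = |ξ|^{-d/2} |ln |ξ||^{-1/2} 1_{(0,1/2)^d}(ξ)`. -/
noncomputable def logSingular (d : ℕ) : EuclideanSpace ℝ (Fin d) → ℂ :=
  Set.indicator {ξ | ∀ i, ξ i ∈ Set.Ioo (0 : ℝ) (1 / 2)} fun ξ =>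
    ((‖ξ‖ ^ (-(d : ℝ) / 2) * |Real.log ‖ξ‖| ^ (-(1 : ℝ) / 2) : ℝ) : ℂ)

end ScaledModulation

/-!
The multiplier `ψ_{j,k}(D) f` is the inverse Fourier transform of `ψ_{j,k} 𝓕 f`, so the first
bound is the Hausdorff–Young inequality `‖𝓕⁻ u‖_p ≤ ‖u‖_{p'}`, with constant one, applied to each
term of the sums; the weights agree. The inequality is proved here for tempered distributions in
`L^{p'}`: the three lines theorem interpolates the bilinear form `∫ 𝓕⁻ f * g` on simple functions
between `L^1` and `L^2` (`enorm_integral_fourierInv_mul_le_simpleFunc`), duality turns this into a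
norm bound (`eLpNorm_le_of_forall_simpleFunc`), and density of the simple functions extends it to
all of `L^{p'}` (`exists_Lp_eq_fourierInv`).

By Plancherel's theorem the remaining claims concern the norm of `X_{s,q}` with `s = p' < 2 < q`,
for functions on the Fourier side. Up to a factor `sup |ψ|` it is bounded by the sum `boxSum` over
the dyadic cubes that contain the supports of the `ψ_{j,k}` (`xNorm_le_boxSum`). At each scale
`2^j` the function `u` may be split in two: on one part `ℓ^1 ⊂ ℓ^{q/s}` reduces the sum over the
cubes to `∫ u^s`, on the other Hölder's inequality reduces it to `∫ u^q` (`boxSum_le_of_split`).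

* For `u` in `L^2` the split is at the height `u = 2^{-jd/2}`. The sums over `j` are then
  geometric at each point, with total comparable to `u^2` (`boxSum_le_of_lintegral_sq`).
* Near the origin, `g` is split at `|ξ| = 2^j`. The dyadic annulus `|ξ| ~ 2^{-n}` contributes
  `n^{-q/2}`, which is summable as `q > 2` (`boxSum_logSingular_near_lt_top`), while its
  contribution to `∫ g^2` is of order `1 / n`, which is not (`lintegral_logSingular_sq`).
* In high dimensions the cube `(0, 1/2)^d` meets the unit sphere, where `ln |ξ|` vanishes and `g`
  behaves like `|1 - |ξ||^{-1/2}`. The integral of `|1 - |ξ||^{-s/2}` over a cube of side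
  `2^j ≤ 1` is `O(2^{j(d - s/2)})` (`setLIntegral_sphereWeight_le`). For `s` close to `2` this
  makes the sum over the scales converge, and smaller `s` follow by Hölder's inequality
  (`boxSum_sphereWeight_lt_top`).

So `𝓕⁻ g` has finite norm, and it is not in `L^2` because `g` is not.
-/

namespace ScaledModulation

/-! ### The Fourier transform on `L^1` and `L^2` -/

section HausdorffYoung

variable {V : Type*} [NormedAddCommGroup V] [InnerProductSpace ℝ V] [FiniteDimensional ℝ V]
  [MeasurableSpace V] [BorelSpace V]

/-- Locally integrable functions that define the same tempered distribution agree almost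
everywhere. -/
theorem ae_eq_of_forall_schwartz {f g : V → ℂ} (hf : LocallyIntegrable f volume)
    (hg : LocallyIntegrable g volume)
    (h : ∀ φ : 𝓢(V, ℂ), ∫ x, φ x * f x = ∫ x, φ x * g x) : f =ᵐ[volume] g := by
  apply ae_eq_of_integral_contDiff_smul_eq hf hg
  intro φ hφ hc
  have hc' : HasCompactSupport (Complex.ofRealCLM ∘ φ) := hc.comp_left rfl
  have hs : ContDiff ℝ (⊤ : ℕ∞) (Complex.ofRealCLM ∘ φ) := Complex.ofRealCLM.contDiff.comp hφ
  simpa using h (hc'.toSchwartzMap hs)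

theorem integral_fourierInv_mul_eq_flip {f g : V → ℂ} (hf : Integrable f) (hg : Integrable g) :
    ∫ x, 𝓕⁻ f x * g x = ∫ x, f x * 𝓕⁻ g x := by
  have h := VectorFourier.integral_fourierIntegral_smul_eq_flip (μ := (volume : Measure V))
    (ν := (volume : Measure V)) (L := -innerₗ V) (f := f) (g := g) (e := 𝐞)
    Real.continuous_fourierChar (by simp; fun_prop) hf hg
  have hflip : (-innerₗ V).flip = -innerₗ V := by
    ext x y; simp [real_inner_comm]
  rw [hflip] at h
  exact h

theorem norm_fourierInv_le (f : V → ℂ) (x : V) : ‖𝓕⁻ f x‖ ≤ ∫ y, ‖f y‖ :=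
  VectorFourier.norm_fourierIntegral_le_integral_norm _ _ _ _ _

theorem continuous_fourierInv {f : V → ℂ} (hf : Integrable f) : Continuous (𝓕⁻ f) :=
  VectorFourier.fourierIntegral_continuous Real.continuous_fourierChar (by simp; fun_prop) hf

/-- The Fourier transform of `L^2` agrees with the integral on `L^1 ∩ L^2`. -/
theorem fourierInv_toLp_ae_eq {f : V → ℂ} (hf1 : Integrable f) (hf2 : MemLp f 2 volume) :
    (𝓕⁻ (hf2.toLp f) : Lp ℂ 2 (volume : Measure V)) =ᵐ[volume] 𝓕⁻ f := by
  apply ae_eq_of_forall_schwartz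
  · exact (Lp.memLp _).locallyIntegrable (by norm_num)
  · exact (continuous_fourierInv hf1).locallyIntegrable
  intro φ
  have h := congrArg (fun u : 𝓢'(V, ℂ) => u φ)
    (Lp.fourierInv_toTemperedDistribution_eq (hf2.toLp f))
  simp only [TemperedDistribution.fourierInv_apply, Lp.toTemperedDistribution_apply,
    smul_eq_mul] at h
  rw [← h, ← integral_fourierInv_mul_eq_flip φ.integrable hf1]
  apply integral_congr_ae
  filter_upwards [hf2.coeFn_toLp] with x hx
  rw [hx, SchwartzMap.fourierInv_coe]

theorem memLp_two_fourierInv {f : V → ℂ} (hf1 : Integrable f) (hf2 : MemLp f 2 volume) :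
    MemLp (𝓕⁻ f) 2 volume :=
  (memLp_congr_ae (fourierInv_toLp_ae_eq hf1 hf2)).1 (Lp.memLp _)

/-- Plancherel's theorem for the Fourier integral on `L^1 ∩ L^2`. -/
theorem eLpNorm_two_fourierInv {f : V → ℂ} (hf1 : Integrable f) (hf2 : MemLp f 2 volume) :
    eLpNorm (𝓕⁻ f) 2 volume = eLpNorm f 2 volume := by
  rw [← eLpNorm_congr_ae (fourierInv_toLp_ae_eq hf1 hf2), ← eLpNorm_congr_ae hf2.coeFn_toLp,
    ← Lp.enorm_def, ← Lp.enorm_def]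
  have : ‖𝓕⁻ (hf2.toLp f)‖ = ‖hf2.toLp f‖ := (Lp.fourierTransformₗᵢ V ℂ).symm.norm_map _
  rw [← ofReal_norm, ← ofReal_norm, this]

/-- The endpoint `s = 1` of the interpolation. -/
theorem enorm_integral_fourierInv_mul_le_one {f g : V → ℂ} (hf : Integrable f) :
    ‖∫ x, 𝓕⁻ f x * g x‖ₑ ≤ eLpNorm f 1 volume * eLpNorm g 1 volume := by
  calc ‖∫ x, 𝓕⁻ f x * g x‖ₑ ≤ ∫⁻ x, ‖𝓕⁻ f x * g x‖ₑ := enorm_integral_le_lintegral_enorm _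
    _ ≤ ∫⁻ x, eLpNorm f 1 volume * ‖g x‖ₑ := by
        gcongr with x
        rw [enorm_mul]
        gcongr
        rw [eLpNorm_one_eq_lintegral_enorm, ← ofReal_integral_norm_eq_lintegral_enorm hf,
          ← ofReal_norm]
        exact ENNReal.ofReal_le_ofReal (norm_fourierInv_le f x)
    _ = _ := by
        rw [lintegral_const_mul', eLpNorm_one_eq_lintegral_enorm (f := g)]
        exact (memLp_one_iff_integrable.2 hf).2.ne

/-- The endpoint `s = 2` of the interpolation. -/
theorem enorm_integral_fourierInv_mul_le_two {f g : V → ℂ} (hf : Integrable f)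
    (hf2 : MemLp f 2 volume) (hg2 : MemLp g 2 volume) :
    ‖∫ x, 𝓕⁻ f x * g x‖ₑ ≤ eLpNorm f 2 volume * eLpNorm g 2 volume := by
  calc ‖∫ x, 𝓕⁻ f x * g x‖ₑ ≤ ∫⁻ x, ‖𝓕⁻ f x * g x‖ₑ := enorm_integral_le_lintegral_enorm _
    _ = eLpNorm (fun x => 𝓕⁻ f x * g x) 1 volume := by rw [eLpNorm_one_eq_lintegral_enorm]
    _ ≤ eLpNorm (𝓕⁻ f) 2 volume * eLpNorm g 2 volume := by
        have := eLpNorm_le_eLpNorm_mul_eLpNorm'_of_norm (p := 2) (q := 2) (r := 1)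
          (memLp_two_fourierInv hf hf2).1 hg2.1 (fun a b => a * b) 1
          (by filter_upwards with x; simp)
        simpa using this
    _ = _ := by rw [eLpNorm_two_fourierInv hf hf2]

/-! ### Interpolation by the three lines theorem -/

/-- The analytic family `a |a|^{s (1 - z / 2) - 1}`. Its modulus is `|a|^s` for `re z = 0` and
`|a|^{s / 2}` for `re z = 1`, and it takes the value `a` at `z = 2 - 2 / s`. -/
noncomputable def powerFamily (s : ℝ) (z a : ℂ) : ℂ :=
  a * (‖a‖ : ℂ) ^ ((s : ℂ) * (1 - z / 2) - 1)

@[simp]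
theorem powerFamily_zero (s : ℝ) (z : ℂ) : powerFamily s z 0 = 0 := by simp [powerFamily]

theorem norm_powerFamily (s : ℝ) (z : ℂ) {a : ℂ} (ha : a ≠ 0) :
    ‖powerFamily s z a‖ = ‖a‖ ^ (s * (1 - z.re / 2)) := by
  have h : 0 < ‖a‖ := norm_pos_iff.2 ha
  rw [powerFamily, norm_mul, Complex.norm_cpow_eq_rpow_re_of_pos h]
  have : ((s : ℂ) * (1 - z / 2) - 1).re = s * (1 - z.re / 2) - 1 := by simp
  rw [this, Real.rpow_sub_one h.ne']
  field_simp

theorem enorm_powerFamily {s : ℝ} (hs : 0 < s) {z : ℂ} (hz : z.re ≤ 1) (a : ℂ) :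
    ‖powerFamily s z a‖ₑ = ‖a‖ₑ ^ (s * (1 - z.re / 2)) := by
  have hpos : 0 < s * (1 - z.re / 2) := mul_pos hs (by linarith)
  rcases eq_or_ne a 0 with rfl | ha
  · simp [ENNReal.zero_rpow_of_pos hpos]
  · rw [← ofReal_norm, norm_powerFamily s z ha, ← ofReal_norm,
      ENNReal.ofReal_rpow_of_nonneg (norm_nonneg _) hpos.le]

theorem powerFamily_eq_self {s : ℝ} (hs : s ≠ 0) (a : ℂ) :
    powerFamily s ((2 - 2 / s : ℝ) : ℂ) a = a := by
  have : (s : ℂ) * (1 - ((2 - 2 / s : ℝ) : ℂ) / 2) - 1 = 0 := by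
    have : (s : ℂ) ≠ 0 := by exact_mod_cast hs
    push_cast
    field_simp
    ring
  rw [powerFamily, this, Complex.cpow_zero, mul_one]

theorem differentiable_powerFamily (s : ℝ) (a : ℂ) :
    Differentiable ℂ (fun z => powerFamily s z a) := by
  rcases eq_or_ne a 0 with rfl | ha
  · simp
  · have : (‖a‖ : ℂ) ≠ 0 := by simpa using ha
    intro z
    unfold powerFamily
    apply DifferentiableAt.const_mul
    apply DifferentiableAt.const_cpow
    · fun_prop
    · exact Or.inl this

theorem norm_powerFamily_le {s : ℝ} (hs : 0 < s) {z : ℂ} (hz0 : 0 ≤ z.re) (hz : z.re ≤ 1)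
    (a : ℂ) : ‖powerFamily s z a‖ ≤ max 1 ‖a‖ ^ s := by
  rcases eq_or_ne a 0 with rfl | ha
  · simp
  · rw [norm_powerFamily s z ha]
    calc ‖a‖ ^ (s * (1 - z.re / 2)) ≤ max 1 ‖a‖ ^ (s * (1 - z.re / 2)) := by
          gcongr
          · nlinarith
          · exact le_max_right _ _
      _ ≤ max 1 ‖a‖ ^ s := by
          apply Real.rpow_le_rpow_of_exponent_le (le_max_left _ _)
          nlinarith

/-- Composition of a simple function with a map that fixes `0`, as a finite sum. The point `0` is
left out because its level set may have infinite measure. -/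
theorem simpleFunc_comp_eq_sum {α : Type*} [MeasurableSpace α] (f : SimpleFunc α ℂ)
    {c : ℂ → ℂ} (hc : c 0 = 0) (x : α) :
    c (f x) = ∑ a ∈ f.range.erase 0, c a * (f ⁻¹' {a}).indicator 1 x := by
  classical
  by_cases h : f x = 0
  · rw [h, hc, Finset.sum_eq_zero]
    intro a ha
    have : x ∉ f ⁻¹' {a} := by
      simp only [Set.mem_preimage, Set.mem_singleton_iff, h]
      exact fun h' => (Finset.mem_erase.1 ha).1 h'.symm
    simp [this]
  · rw [Finset.sum_eq_single (f x)]
    · simp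
    · intro b _ hb
      have : x ∉ f ⁻¹' {b} := by
        simpa using hb.symm
      simp [this]
    · intro h'
      exact absurd (Finset.mem_erase.2 ⟨h, f.mem_range_self x⟩) h'

theorem integrable_indicator_preimage {f : SimpleFunc V ℂ} (hf : Integrable f volume)
    {a : ℂ} (ha : a ≠ 0) : Integrable ((f ⁻¹' {a}).indicator (1 : V → ℂ)) volume := by
  have h := SimpleFunc.measure_preimage_lt_top_of_memLp one_ne_zero ENNReal.one_ne_top f
    (memLp_one_iff_integrable.2 hf) a ha
  exact (integrable_indicator_iff (f.measurableSet_preimage _)).2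
    (integrableOn_const h.ne)

theorem fourierInv_simpleFunc_comp {f : SimpleFunc V ℂ} (hf : Integrable f volume) {c : ℂ → ℂ}
    (hc : c 0 = 0) (x : V) :
    𝓕⁻ (fun y => c (f y)) x =
      ∑ a ∈ f.range.erase 0, c a * 𝓕⁻ ((f ⁻¹' {a}).indicator (1 : V → ℂ)) x := by
  simp only [Real.fourierInv_eq, ← integral_const_mul]
  rw [← integral_finsetSum]
  · congr 1 with y
    rw [simpleFunc_comp_eq_sum f hc, Finset.smul_sum]
    refine Finset.sum_congr rfl fun a _ => ?_
    rw [mul_smul_comm]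
  · intro a ha
    apply Integrable.const_mul
    have := (Real.fourierIntegral_convergent_iff (-x)).2
      (integrable_indicator_preimage hf (Finset.mem_erase.1 ha).1)
    simpa using this

/-- For simple functions the bilinear form is a finite sum of products `c a * c b` with fixed
coefficients, hence entire in `z` when `c = powerFamily s z`. -/
theorem integral_fourierInv_mul_simpleFunc {f g : SimpleFunc V ℂ} (hf : Integrable f volume)
    (hg : Integrable g volume) {c : ℂ → ℂ} (hc : c 0 = 0) :
    ∫ x, 𝓕⁻ (fun y => c (f y)) x * c (g x) =
      ∑ a ∈ f.range.erase 0, ∑ b ∈ g.range.erase 0, c a * c b *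
        ∫ x, 𝓕⁻ ((f ⁻¹' {a}).indicator (1 : V → ℂ)) x *
          (g ⁻¹' {b}).indicator (1 : V → ℂ) x := by
  have hi : ∀ a ∈ f.range.erase 0, ∀ b ∈ g.range.erase 0, Integrable (fun x =>
      𝓕⁻ ((f ⁻¹' {a}).indicator (1 : V → ℂ)) x * (g ⁻¹' {b}).indicator (1 : V → ℂ) x) := by
    intro a ha b hb
    have h1 := integrable_indicator_preimage hf (Finset.mem_erase.1 ha).1
    have h2 := integrable_indicator_preimage hg (Finset.mem_erase.1 hb).1
    exact h2.bdd_mul (continuous_fourierInv h1).aestronglyMeasurable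
      (Filter.Eventually.of_forall fun x => norm_fourierInv_le _ x)
  calc ∫ x, 𝓕⁻ (fun y => c (f y)) x * c (g x)
      = ∫ x, ∑ a ∈ f.range.erase 0, ∑ b ∈ g.range.erase 0, c a * c b *
        (𝓕⁻ ((f ⁻¹' {a}).indicator (1 : V → ℂ)) x * (g ⁻¹' {b}).indicator (1 : V → ℂ) x) := by
        congr 1 with x
        rw [fourierInv_simpleFunc_comp hf hc, simpleFunc_comp_eq_sum g hc, Finset.sum_mul_sum]
        refine Finset.sum_congr rfl fun a _ => Finset.sum_congr rfl fun b _ => ?_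
        ring
    _ = _ := by
        rw [integral_finsetSum _ fun a ha => integrable_finsetSum _ fun b hb =>
          (hi a ha b hb).const_mul _]
        refine Finset.sum_congr rfl fun a ha => ?_
        rw [integral_finsetSum _ fun b hb => (hi a ha b hb).const_mul _]
        refine Finset.sum_congr rfl fun b _ => ?_
        rw [integral_const_mul]

theorem eLpNorm_one_powerFamily {s : ℝ} (hs : 0 < s) {z : ℂ} (hz : z.re = 0) (f : V → ℂ) :
    eLpNorm (fun x => powerFamily s z (f x)) 1 volume = ∫⁻ x, ‖f x‖ₑ ^ s := by
  rw [eLpNorm_one_eq_lintegral_enorm]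
  simp only [enorm_powerFamily hs (hz.trans_le zero_le_one), hz]
  norm_num

theorem eLpNorm_two_powerFamily {s : ℝ} (hs : 0 < s) {z : ℂ} (hz : z.re = 1) (f : V → ℂ) :
    eLpNorm (fun x => powerFamily s z (f x)) 2 volume = (∫⁻ x, ‖f x‖ₑ ^ s) ^ (1 / 2 : ℝ) := by
  rw [eLpNorm_eq_lintegral_rpow_enorm_toReal two_ne_zero ENNReal.ofNat_ne_top]
  simp only [enorm_powerFamily hs hz.le, hz, ← ENNReal.rpow_mul, ENNReal.toReal_ofNat]
  congr 3 with x
  congr 1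
  ring

theorem memLp_simpleFunc_comp {f : SimpleFunc V ℂ} (hf : Integrable f volume) {c : ℂ → ℂ}
    (hc : c 0 = 0) (r : ℝ≥0∞) : MemLp (fun x => c (f x)) r volume := by
  have : (fun x => c (f x)) = ⇑(f.map c) := rfl
  rw [this]
  apply SimpleFunc.memLp_of_finite_measure_preimage
  intro y hy
  rw [SimpleFunc.map_preimage_singleton]
  refine (measure_mono ?_).trans_lt (SimpleFunc.finMeasSupp_iff_support.1
    ((SimpleFunc.integrable_iff_finMeasSupp).1 hf))
  intro x hx h0
  have h1 : c (f x) = y := by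
    have := hx
    rw [← SimpleFunc.map_preimage_singleton] at this
    simpa using this
  rw [h0, hc] at h1
  exact hy h1.symm

/-- Interpolation of the bilinear form `∫ 𝓕⁻ f * g` between `L^1 × L^1` and `L^2 × L^2`: the three
lines theorem applied to `z ↦ ∫ 𝓕⁻ (powerFamily s z ∘ f) * (powerFamily s z ∘ g)`. -/
theorem enorm_integral_fourierInv_mul_le_simpleFunc {s : ℝ} (hs1 : 1 ≤ s) (hs2 : s ≤ 2)
    {f g : SimpleFunc V ℂ} (hf : Integrable f volume) (hg : Integrable g volume) :
    ‖∫ x, 𝓕⁻ (f : V → ℂ) x * g x‖ₑ ≤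
      (∫⁻ x, ‖f x‖ₑ ^ s) ^ (1 / s) * (∫⁻ x, ‖g x‖ₑ ^ s) ^ (1 / s) := by
  have hs : 0 < s := by linarith
  have hfin : ∀ {h : SimpleFunc V ℂ}, Integrable h volume → ∫⁻ x, ‖h x‖ₑ ^ s ≠ ∞ := by
    intro h hh
    rw [← eLpNorm_one_powerFamily hs (z := 0) rfl]
    exact (memLp_simpleFunc_comp hh (powerFamily_zero s 0) 1).2.ne
  set N : ℝ≥0∞ := (∫⁻ x, ‖f x‖ₑ ^ s) * ∫⁻ x, ‖g x‖ₑ ^ s with hN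
  have hNfin : N ≠ ∞ := ENNReal.mul_ne_top (hfin hf) (hfin hg)
  set F : ℂ → ℂ := fun z => ∫ x, 𝓕⁻ (fun y => powerFamily s z (f y)) x * powerFamily s z (g x)
    with hF
  have hFsum : ∀ z, F z = _ := fun z =>
    integral_fourierInv_mul_simpleFunc hf hg (powerFamily_zero s z)
  have hmem : ∀ {h : SimpleFunc V ℂ}, Integrable h volume → ∀ z (r : ℝ≥0∞),
      MemLp (fun x => powerFamily s z (h x)) r volume := fun hh z r =>
    memLp_simpleFunc_comp hh (powerFamily_zero s z) r
  have hF0 : ∀ z ∈ Complex.re ⁻¹' {0}, ‖F z‖ ≤ N.toReal := by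
    intro z hz
    rw [← toReal_enorm]
    apply ENNReal.toReal_mono hNfin
    refine (enorm_integral_fourierInv_mul_le_one
      (memLp_one_iff_integrable.1 (hmem hf z 1))).trans_eq ?_
    rw [eLpNorm_one_powerFamily hs hz, eLpNorm_one_powerFamily hs hz]
  have hF1 : ∀ z ∈ Complex.re ⁻¹' {1}, ‖F z‖ ≤ N.toReal ^ (1 / 2 : ℝ) := by
    intro z hz
    rw [← toReal_enorm, ENNReal.toReal_rpow]
    apply ENNReal.toReal_mono (ENNReal.rpow_ne_top_of_nonneg (by norm_num) hNfin)
    refine (enorm_integral_fourierInv_mul_le_two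
      (memLp_one_iff_integrable.1 (hmem hf z 1)) (hmem hf z 2) (hmem hg z 2)).trans_eq ?_
    rw [eLpNorm_two_powerFamily hs hz, eLpNorm_two_powerFamily hs hz,
      ENNReal.mul_rpow_of_nonneg _ _ (by norm_num)]
  have hd : Differentiable ℂ F := by
    have : F = fun z => _ := funext hFsum
    rw [this]
    have := differentiable_powerFamily s
    fun_prop
  have hB : BddAbove ((norm ∘ F) '' Complex.HadamardThreeLines.verticalClosedStrip 0 1) := by
    refine ⟨∑ a ∈ f.range.erase 0, ∑ b ∈ g.range.erase 0, max 1 ‖a‖ ^ s * max 1 ‖b‖ ^ s *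
        ‖∫ x, 𝓕⁻ ((f ⁻¹' {a}).indicator (1 : V → ℂ)) x *
          (g ⁻¹' {b}).indicator (1 : V → ℂ) x‖, ?_⟩
    rintro _ ⟨z, hz, rfl⟩
    simp only [Function.comp_apply, hFsum z]
    refine (norm_sum_le _ _).trans (Finset.sum_le_sum fun a _ => (norm_sum_le _ _).trans
      (Finset.sum_le_sum fun b _ => ?_))
    rw [norm_mul, norm_mul]
    gcongr
    · exact norm_powerFamily_le hs hz.1 hz.2 a
    · exact norm_powerFamily_le hs hz.1 hz.2 b
  -- the point of the strip at which the analytic family passes through `f` and `g`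
  set θ : ℝ := 2 - 2 / s with hθ
  have hθ0 : 0 ≤ θ := by
    rw [hθ, sub_nonneg, div_le_iff₀ hs]; linarith
  have hθ1 : θ ≤ 1 := by
    have : 1 ≤ 2 / s := by rw [le_div_iff₀ hs]; linarith
    linarith
  have key := Complex.HadamardThreeLines.norm_le_interp_of_mem_verticalClosedStrip₀₁' F
    (z := (θ : ℂ)) (a := N.toReal) (b := N.toReal ^ (1 / 2 : ℝ)) ⟨by simpa, by simpa⟩
    hd.diffContOnCl hB hF0 hF1
  have hFθ : F θ = ∫ x, 𝓕⁻ (f : V → ℂ) x * g x := by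
    simp only [hF, hθ, powerFamily_eq_self hs.ne']
  rw [hFθ, Complex.ofReal_re, ← Real.rpow_mul ENNReal.toReal_nonneg,
    ← Real.rpow_add_of_nonneg ENNReal.toReal_nonneg (by linarith) (by positivity)] at key
  have hexp : 1 - θ + 1 / 2 * θ = 1 / s := by rw [hθ]; field_simp; ring
  rw [hexp, ENNReal.toReal_rpow, ← toReal_enorm, ENNReal.toReal_le_toReal (by simp)
    (ENNReal.rpow_ne_top_of_nonneg (by positivity) hNfin), hN,
    ENNReal.mul_rpow_of_nonneg _ _ (by positivity)] at key
  exact key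

/-! ### Duality and the Hausdorff–Young inequality -/

theorem eLpNorm_ofReal {α : Type*} [MeasurableSpace α] {μ : Measure α} {s : ℝ} (hs : 0 < s)
    (f : α → ℂ) : eLpNorm f (ENNReal.ofReal s) μ = (∫⁻ x, ‖f x‖ₑ ^ s ∂μ) ^ (1 / s) := by
  rw [eLpNorm_eq_lintegral_rpow_enorm_toReal (by simpa using hs) ENNReal.ofReal_ne_top,
    ENNReal.toReal_ofReal hs.le]

/-- The qualitative membership, by `L^2 ∩ L^∞ ⊂ L^p`; duality needs it before the norm can be
estimated. -/
theorem memLp_fourierInv {p : ℝ} (hp : 2 ≤ p) {f : V → ℂ} (hf : Integrable f)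
    (hf2 : MemLp f 2 volume) : MemLp (𝓕⁻ f) (ENNReal.ofReal p) volume := by
  have hH := memLp_two_fourierInv hf hf2
  refine ⟨hH.1, ?_⟩
  rw [eLpNorm_ofReal (by linarith)]
  apply ENNReal.rpow_lt_top_of_nonneg (by positivity)
  have h2 : ∫⁻ x, ‖𝓕⁻ f x‖ₑ ^ (2 : ℝ) ≠ ∞ := by
    have h := hH.2
    rw [eLpNorm_lt_top_iff_lintegral_rpow_enorm_lt_top two_ne_zero ENNReal.ofNat_ne_top] at h
    simpa using h.ne
  have hM : eLpNorm f 1 volume ^ (p - 2) ≠ ∞ :=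
    ENNReal.rpow_ne_top_of_nonneg (by linarith) (memLp_one_iff_integrable.2 hf).2.ne
  refine ne_top_of_le_ne_top (ENNReal.mul_ne_top hM h2) ?_
  rw [← lintegral_const_mul' _ _ hM]
  gcongr with x
  have hx : ‖𝓕⁻ f x‖ₑ ≤ eLpNorm f 1 volume := by
    rw [eLpNorm_one_eq_lintegral_enorm, ← ofReal_integral_norm_eq_lintegral_enorm hf,
      ← ofReal_norm]
    exact ENNReal.ofReal_le_ofReal (norm_fourierInv_le f x)
  calc ‖𝓕⁻ f x‖ₑ ^ p = ‖𝓕⁻ f x‖ₑ ^ (p - 2) * ‖𝓕⁻ f x‖ₑ ^ (2 : ℝ) := by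
        rw [← ENNReal.rpow_add_of_nonneg _ _ (by linarith) (by norm_num)]; ring_nf
    _ ≤ _ := by gcongr

theorem enorm_integral_mul_le {α : Type*} [MeasurableSpace α] {μ : Measure α} {s p : ℝ}
    (hsp : s.HolderConjugate p) {f g : α → ℂ} (hf : AEStronglyMeasurable f μ)
    (hg : AEStronglyMeasurable g μ) :
    ‖∫ x, f x * g x ∂μ‖ₑ ≤
      eLpNorm f (ENNReal.ofReal s) μ * eLpNorm g (ENNReal.ofReal p) μ := by
  refine (enorm_integral_le_lintegral_enorm _).trans ?_
  simp only [enorm_mul]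
  rw [eLpNorm_ofReal hsp.pos, eLpNorm_ofReal hsp.symm.pos]
  exact ENNReal.lintegral_mul_le_Lp_mul_Lq μ hsp hf.enorm hg.enorm

/-- The `L^p` norm of a function in `L^p` is the supremum of its pairings with simple functions in
the unit ball of `L^s`. -/
theorem eLpNorm_le_of_forall_simpleFunc {α : Type*} [MeasurableSpace α] {μ : Measure α}
    {s p : ℝ} (hsp : s.HolderConjugate p) {H : α → ℂ} (hH : MemLp H (ENNReal.ofReal p) μ)
    {K : ℝ≥0∞} (h : ∀ g : SimpleFunc α ℂ, MemLp g (ENNReal.ofReal s) μ →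
      ‖∫ x, H x * g x ∂μ‖ₑ ≤ K * eLpNorm g (ENNReal.ofReal s) μ) :
    eLpNorm H (ENNReal.ofReal p) μ ≤ K := by
  have hs0 := hsp.pos
  have hp0 := hsp.symm.pos
  rcases eq_or_ne K ∞ with rfl | hK
  · exact le_top
  have : (ENNReal.ofReal p).HolderConjugate (ENNReal.ofReal s) := by
    have := hsp.symm.ennrealOfReal
    exact this
  -- the bound extends to all of `L^s` by density
  have hall : ∀ g : α → ℂ, MemLp g (ENNReal.ofReal s) μ →
      ‖∫ x, H x * g x ∂μ‖ₑ ≤ K * eLpNorm g (ENNReal.ofReal s) μ := by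
    intro g hg
    apply ENNReal.le_of_forall_pos_le_add
    intro δ hδ _
    set A := K + eLpNorm H (ENNReal.ofReal p) μ with hA
    have hAfin : A + 1 ≠ ∞ := by simp [hA, hK, hH.2.ne]
    have hε : (δ : ℝ≥0∞) / (A + 1) ≠ 0 := by
      simp [ENNReal.div_eq_zero_iff, hδ.ne', hAfin]
    obtain ⟨g', hg', hg'm⟩ := hg.exists_simpleFunc_eLpNorm_sub_lt ENNReal.ofReal_ne_top hε
    set ε := (δ : ℝ≥0∞) / (A + 1)
    have hI1 : Integrable (fun x => H x * g' x) μ := hH.integrable_mul hg'm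
    have hI2 : Integrable (fun x => H x * (g - ⇑g') x) μ := hH.integrable_mul (hg.sub hg'm)
    have hsplit : ∫ x, H x * g x ∂μ = ∫ x, H x * g' x ∂μ + ∫ x, H x * (g - ⇑g') x ∂μ := by
      rw [← integral_add hI1 hI2]
      congr 1 with x
      simp [mul_sub]
    have hg'le : eLpNorm g' (ENNReal.ofReal s) μ ≤ eLpNorm g (ENNReal.ofReal s) μ + ε := by
      have h1 : (g' : α → ℂ) = g - (g - ⇑g') := by simp
      calc eLpNorm g' (ENNReal.ofReal s) μ = eLpNorm (g - (g - ⇑g')) (ENNReal.ofReal s) μ := by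
            rw [← h1]
        _ ≤ _ := eLpNorm_sub_le hg.1 (hg.sub hg'm).1
            (by rw [ENNReal.one_le_ofReal]; exact hsp.lt.le)
        _ ≤ _ := by gcongr
    calc ‖∫ x, H x * g x ∂μ‖ₑ ≤ ‖∫ x, H x * g' x ∂μ‖ₑ + ‖∫ x, H x * (g - ⇑g') x ∂μ‖ₑ := by
          rw [hsplit]; exact enorm_add_le _ _
      _ ≤ K * (eLpNorm g (ENNReal.ofReal s) μ + ε) + eLpNorm H (ENNReal.ofReal p) μ * ε := by
          gcongr
          · exact (h g' hg'm).trans (by gcongr)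
          · exact (enorm_integral_mul_le hsp.symm hH.1 (hg.sub hg'm).1).trans (by gcongr)
      _ = K * eLpNorm g (ENNReal.ofReal s) μ + A * ε := by rw [hA]; ring
      _ ≤ K * eLpNorm g (ENNReal.ofReal s) μ + (A + 1) * ε := by gcongr; simp
      _ ≤ _ := by gcongr; exact ENNReal.mul_div_le
  -- test against `conj H * |H| ^ (p - 2)`
  set g : α → ℂ := fun x => starRingEnd ℂ (H x) * ((‖H x‖ ^ (p - 2) : ℝ) : ℂ) with hg
  have hp1 : 1 < p := hsp.symm.lt
  have hgn : ∀ x, ‖g x‖ₑ = ‖H x‖ₑ ^ (p - 1) := by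
    intro x
    rcases eq_or_ne (H x) 0 with h0 | h0
    · simp [hg, h0, hp1]
    · have hpos : 0 < ‖H x‖ := norm_pos_iff.2 h0
      rw [← ofReal_norm, ← ofReal_norm, ENNReal.ofReal_rpow_of_pos hpos]
      congr 1
      simp only [hg, norm_mul, RCLike.norm_conj, Complex.norm_real, Real.norm_eq_abs]
      rw [abs_of_nonneg (by positivity)]
      nth_rw 1 [← Real.rpow_one ‖H x‖]
      rw [← Real.rpow_add hpos]
      ring_nf
  have hHg : ∀ x, H x * g x = ((‖H x‖ ^ p : ℝ) : ℂ) := by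
    intro x
    rcases eq_or_ne (H x) 0 with h0 | h0
    · simp [h0, hp0.ne']
    · have hpos : 0 < ‖H x‖ := norm_pos_iff.2 h0
      simp only [hg]
      rw [← mul_assoc, Complex.mul_conj, Complex.normSq_eq_norm_sq, ← Complex.ofReal_mul]
      congr 1
      rw [← Real.rpow_natCast, ← Real.rpow_add hpos]
      congr 1
      push_cast
      ring
  have hgs : ∀ x, ‖g x‖ₑ ^ s = ‖H x‖ₑ ^ p := by
    intro x
    rw [hgn, ← ENNReal.rpow_mul]
    congr 1
    have := hsp.symm.sub_one_mul_conj
    linarith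
  have hI : ∫⁻ x, ‖H x‖ₑ ^ p ∂μ ≠ ∞ := by
    have h := hH.2
    rw [eLpNorm_lt_top_iff_lintegral_rpow_enorm_lt_top (by simpa using hp0)
      ENNReal.ofReal_ne_top, ENNReal.toReal_ofReal hp0.le] at h
    exact h.ne
  have hgm : AEStronglyMeasurable g μ := by
    have hm := hH.1.aemeasurable
    have : AEMeasurable g μ := by
      simp only [hg]
      fun_prop
    exact this.aestronglyMeasurable
  have hgL : MemLp g (ENNReal.ofReal s) μ := by
    refine ⟨hgm, ?_⟩
    rw [eLpNorm_ofReal hs0]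
    simp only [hgs]
    exact ENNReal.rpow_lt_top_of_nonneg (by positivity) hI
  have hmain := hall g hgL
  rw [eLpNorm_ofReal hs0] at hmain
  simp only [hgs, hHg] at hmain
  have hint : Integrable (fun x => ‖H x‖ ^ p) μ := by
    have := hH.integrable_norm_rpow (by simpa using hp0) ENNReal.ofReal_ne_top
    rwa [ENNReal.toReal_ofReal hp0.le] at this
  rw [integral_complex_ofReal, ← ofReal_norm, Complex.norm_real, Real.norm_eq_abs,
    abs_of_nonneg (integral_nonneg fun x => by positivity),
    ofReal_integral_eq_lintegral_ofReal hint (Filter.Eventually.of_forall fun x => by positivity)]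
    at hmain
  simp only [← ENNReal.ofReal_rpow_of_nonneg (norm_nonneg _) hp0.le, ofReal_norm] at hmain
  rw [eLpNorm_ofReal hp0]
  set I := ∫⁻ x, ‖H x‖ₑ ^ p ∂μ
  rcases eq_or_ne I 0 with h0 | h0
  · simp [h0, hp0]
  have hc0 : I ^ (1 / s) ≠ 0 := by simp [ENNReal.rpow_eq_zero_iff, h0, hI]
  have hct : I ^ (1 / s) ≠ ∞ := ENNReal.rpow_ne_top_of_nonneg (by positivity) hI
  rw [← ENNReal.mul_le_mul_iff_left hc0 hct, ← ENNReal.rpow_add _ _ h0 hI]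
  have : 1 / p + 1 / s = 1 := by
    have := hsp.inv_add_inv_eq_one
    rw [one_div, one_div]; linarith
  rwa [this, ENNReal.rpow_one]

theorem hausdorffYoung_simpleFunc {s p : ℝ} (hsp : s.HolderConjugate p) (hp : 2 ≤ p)
    {f : SimpleFunc V ℂ} (hf : MemLp f (ENNReal.ofReal s) volume) :
    MemLp (𝓕⁻ (f : V → ℂ)) (ENNReal.ofReal p) volume ∧
      eLpNorm (𝓕⁻ (f : V → ℂ)) (ENNReal.ofReal p) volume ≤
        eLpNorm f (ENNReal.ofReal s) volume := by
  have hint : ∀ {g : SimpleFunc V ℂ}, MemLp g (ENNReal.ofReal s) volume →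
      Integrable g volume := fun hg =>
    (SimpleFunc.memLp_iff_integrable (by simpa using hsp.pos) ENNReal.ofReal_ne_top).1 hg
  have hfL := memLp_fourierInv hp (hint hf)
    ((SimpleFunc.memLp_iff_integrable two_ne_zero ENNReal.ofNat_ne_top).2 (hint hf))
  refine ⟨hfL, eLpNorm_le_of_forall_simpleFunc hsp hfL fun g hg => ?_⟩
  have hs2 : s ≤ 2 := by
    have h1 := hsp.inv_add_inv_eq_one
    have h2 : p⁻¹ ≤ 2⁻¹ := inv_anti₀ (by norm_num) hp
    have h3 : (2 : ℝ)⁻¹ ≤ s⁻¹ := by linarith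
    exact (inv_le_inv₀ (by norm_num) hsp.pos).1 h3
  rw [eLpNorm_ofReal hsp.pos, eLpNorm_ofReal hsp.pos]
  exact enorm_integral_fourierInv_mul_le_simpleFunc hsp.lt.le hs2 (hint hf) (hint hg)

theorem fourierInv_sub {f g : V → ℂ} (hf : Integrable f) (hg : Integrable g) :
    𝓕⁻ (f - g) = 𝓕⁻ f - 𝓕⁻ g := by
  ext x
  simp only [Real.fourierInv_eq, Pi.sub_apply, smul_sub]
  have h : ∀ {f : V → ℂ}, Integrable f →
      Integrable (fun y => Real.fourierChar (inner ℝ y x) • f y) := by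
    intro f hf
    have := (Real.fourierIntegral_convergent_iff (-x)).2 hf
    simpa using this
  exact integral_sub (h hf) (h hg)

/-- **Hausdorff–Young inequality** with constant one, for the inverse Fourier transform of
tempered distributions. -/
theorem exists_Lp_eq_fourierInv {s p : ℝ} (hsp : s.HolderConjugate p) (hp : 2 ≤ p)
    [Fact (1 ≤ ENNReal.ofReal s)] [Fact (1 ≤ ENNReal.ofReal p)]
    (g : Lp ℂ (ENNReal.ofReal s) (volume : Measure V)) :
    ∃ h : Lp ℂ (ENNReal.ofReal p) (volume : Measure V),
      ‖h‖ ≤ ‖g‖ ∧ 𝓕⁻ (g : 𝓢'(V, ℂ)) = (h : 𝓢'(V, ℂ)) := by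
  have hint : ∀ {g : SimpleFunc V ℂ}, MemLp g (ENNReal.ofReal s) volume →
      Integrable g volume := fun hg =>
    (SimpleFunc.memLp_iff_integrable (by simpa using hsp.pos) ENNReal.ofReal_ne_top).1 hg
  have hex : ∀ n : ℕ, ∃ f : SimpleFunc V ℂ, MemLp f (ENNReal.ofReal s) volume ∧
      eLpNorm (⇑g - ⇑f) (ENNReal.ofReal s) volume < ((n : ℝ≥0∞) + 1)⁻¹ := fun n => by
    obtain ⟨f, h1, h2⟩ := (Lp.memLp g).exists_simpleFunc_eLpNorm_sub_lt ENNReal.ofReal_ne_top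
      (ε := ((n : ℝ≥0∞) + 1)⁻¹) (by simp)
    exact ⟨f, h2, h1⟩
  choose f hf hfg using hex
  set u : ℕ → Lp ℂ (ENNReal.ofReal s) (volume : Measure V) := fun n => (hf n).toLp (f n)
  set v : ℕ → Lp ℂ (ENNReal.ofReal p) (volume : Measure V) := fun n =>
    (hausdorffYoung_simpleFunc hsp hp (hf n)).1.toLp _
  have hu : Filter.Tendsto u Filter.atTop (nhds g) := by
    rw [tendsto_iff_edist_tendsto_0]
    refine tendsto_of_tendsto_of_tendsto_of_le_of_le tendsto_const_nhds
      (h := fun n : ℕ => ((n : ℝ≥0∞) + 1)⁻¹) ?_ (fun _ => zero_le) fun n => ?_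
    · have := ENNReal.tendsto_inv_nat_nhds_zero.comp (Filter.tendsto_add_atTop_nat 1)
      simpa [Function.comp_def] using this
    · rw [edist_comm, Lp.edist_def]
      refine le_trans (eLpNorm_congr_ae ?_).le (hfg n).le
      filter_upwards [(hf n).coeFn_toLp] with x hx
      simp [u, hx]
  have hdist : ∀ n m, dist (v n) (v m) ≤ dist (u n) (u m) := by
    intro n m
    have h1 : edist (v n) (v m) ≤ edist (u n) (u m) := by
      simp only [v, u, Lp.edist_toLp_toLp]
      rw [← fourierInv_sub (hint (hf n)) (hint (hf m))]
      have hm : MemLp (⇑(f n - f m)) (ENNReal.ofReal s) volume := by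
        rw [SimpleFunc.coe_sub]; exact (hf n).sub (hf m)
      have := (hausdorffYoung_simpleFunc hsp hp hm).2
      rwa [SimpleFunc.coe_sub] at this
    rw [edist_dist, edist_dist] at h1
    exact (ENNReal.ofReal_le_ofReal_iff dist_nonneg).1 h1
  have hv : CauchySeq v := by
    have hc := hu.cauchySeq
    rw [Metric.cauchySeq_iff] at hc ⊢
    intro ε hε
    obtain ⟨N, hN⟩ := hc ε hε
    exact ⟨N, fun m hm n hn => (hdist m n).trans_lt (hN m hm n hn)⟩
  obtain ⟨h, hh⟩ := cauchySeq_tendsto_of_complete hv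
  refine ⟨h, ?_, ?_⟩
  · refine le_of_tendsto_of_tendsto' hh.norm hu.norm fun n => ?_
    rw [Lp.norm_toLp, Lp.norm_toLp]
    exact ENNReal.toReal_mono (hf n).2.ne (hausdorffYoung_simpleFunc hsp hp (hf n)).2
  · have huv : ∀ n, 𝓕⁻ (u n : 𝓢'(V, ℂ)) = (v n : 𝓢'(V, ℂ)) := by
      intro n
      ext φ
      simp only [TemperedDistribution.fourierInv_apply, Lp.toTemperedDistribution_apply,
        smul_eq_mul]
      have h1 : ∫ x, φ x * v n x = ∫ x, φ x * 𝓕⁻ (f n : V → ℂ) x := by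
        apply integral_congr_ae
        filter_upwards [(hausdorffYoung_simpleFunc hsp hp (hf n)).1.coeFn_toLp] with x hx
        simp only [v, hx]
      have h2 : ∫ x, (𝓕⁻ φ) x * u n x = ∫ x, 𝓕⁻ (φ : V → ℂ) x * f n x := by
        apply integral_congr_ae
        filter_upwards [(hf n).coeFn_toLp] with x hx
        simp only [u, hx, SchwartzMap.fourierInv_coe]
      rw [h1, h2, integral_fourierInv_mul_eq_flip φ.integrable (hint (hf n))]
    have hc1 := ((FourierTransform.fourierInvCLM ℂ 𝓢'(V, ℂ)).continuous.comp
      (Lp.toTemperedDistributionCLM ℂ (volume : Measure V) (ENNReal.ofReal s)).continuous).tendsto g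
    have hc2 := (Lp.toTemperedDistributionCLM ℂ (volume : Measure V)
      (ENNReal.ofReal p)).continuous.tendsto h
    refine tendsto_nhds_unique (hc1.comp hu) ((hc2.comp hh).congr fun n => ?_)
    simp [huv n]

end HausdorffYoung

/-! ### The embedding of `ℱX_{p',q}` -/

section Embedding

variable {d : ℕ}

/-- Without `MemLp`: if the norm of `g` is infinite, there is nothing to prove. -/
theorem distLpNorm_le {p : ℝ} {u : 𝓢'(EuclideanSpace ℝ (Fin d), ℂ)}
    {g : EuclideanSpace ℝ (Fin d) → ℂ} (hg : AEStronglyMeasurable g volume)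
    (h : ∀ φ : 𝓢(EuclideanSpace ℝ (Fin d), ℂ), u φ = ∫ x, φ x * g x) :
    distLpNorm p u ≤ eLpNorm g (ENNReal.ofReal p) volume := by
  by_cases hfin : eLpNorm g (ENNReal.ofReal p) volume < ∞
  · exact iInf₂_le_of_le g ⟨hg, hfin⟩ (iInf_le _ h)
  · rw [not_lt_top_iff.1 hfin]
    exact le_top

/-- Hausdorff–Young for `distLpNorm`, including the value `∞`. -/
theorem distLpNorm_fourierInv_le {s p : ℝ} (hsp : s.HolderConjugate p) (hp : 2 ≤ p)
    (u : 𝓢'(EuclideanSpace ℝ (Fin d), ℂ)) : distLpNorm p (𝓕⁻ u) ≤ distLpNorm s u := by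
  have : Fact (1 ≤ ENNReal.ofReal s) := ⟨by rw [ENNReal.one_le_ofReal]; exact hsp.lt.le⟩
  have : Fact (1 ≤ ENNReal.ofReal p) := ⟨by rw [ENNReal.one_le_ofReal]; linarith⟩
  refine le_iInf fun g => le_iInf fun hg => le_iInf fun hu => ?_
  obtain ⟨h, hle, hF⟩ := exists_Lp_eq_fourierInv hsp hp (hg.toLp g)
  have huu : u = (hg.toLp g : 𝓢'(EuclideanSpace ℝ (Fin d), ℂ)) := by
    ext φ
    rw [hu, Lp.toTemperedDistribution_apply]
    apply integral_congr_ae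
    filter_upwards [hg.coeFn_toLp] with x hx
    rw [hx, smul_eq_mul]
  refine (distLpNorm_le (g := h) (Lp.memLp h).1 fun φ => ?_).trans ?_
  · rw [huu, hF, Lp.toTemperedDistribution_apply]
    rfl
  · have h1 : ‖h‖ₑ ≤ ‖hg.toLp g‖ₑ := by
      rw [← ofReal_norm, ← ofReal_norm]
      exact ENNReal.ofReal_le_ofReal hle
    rw [Lp.enorm_def, Lp.enorm_def, eLpNorm_congr_ae hg.coeFn_toLp] at h1
    exact h1

theorem weight_rpow (d : ℕ) (p q : ℝ) (j : ℤ) :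
    (weight d p j : ℝ≥0∞) ^ q =
      (2 : ℝ≥0∞) ^ ((j : ℝ) * d * ((p.conjExponent - 2) / (2 * p.conjExponent)) * q) := by
  rw [weight, ENNReal.coe_rpow_of_ne_zero two_ne_zero, ← ENNReal.rpow_mul]
  rfl

/-- The two norms carry the same weights, and `ψ_{j,k}(D) f = 𝓕⁻ (ψ_{j,k} 𝓕 f)`, so
Hausdorff–Young applies term by term. -/
theorem modNorm_le_fxNorm (ψ : 𝓢(EuclideanSpace ℝ (Fin d), ℂ)) {p q : ℝ} (hp : 2 < p)
    (hq : 1 ≤ q) (f : 𝓢'(EuclideanSpace ℝ (Fin d), ℂ)) :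
    modNorm ψ (weight d p) p q q f ≤ fxNorm ψ p.conjExponent q f := by
  have hsp : p.conjExponent.HolderConjugate p :=
    (Real.HolderConjugate.conjExponent (by linarith)).symm
  have hj : ∀ j, scaledModNorm ψ p q j f ^ q = ∑' k : Fin d → ℤ,
      distLpNorm p (TemperedDistribution.fourierMultiplierCLM ℂ (psiJK ψ j k) f) ^ q := fun j => by
    rw [scaledModNorm, ← ENNReal.rpow_mul, one_div_mul_cancel (by linarith), ENNReal.rpow_one]
  simp only [modNorm, fxNorm, xNorm, hj, weight_rpow]
  gcongr with j k
  rw [TemperedDistribution.fourierMultiplierCLM_apply]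
  exact distLpNorm_fourierInv_le hsp hp.le _

end Embedding

/-! ### Sums and integrals of powers -/

section ENNRealLemmas

/-- The embedding `ℓ^1 ⊂ ℓ^r`. -/
theorem tsum_rpow_le_rpow_tsum {ι : Type*} {r : ℝ} (hr : 1 ≤ r) (a : ι → ℝ≥0∞) :
    ∑' i, a i ^ r ≤ (∑' i, a i) ^ r := by
  have h : ∀ x : ℝ≥0∞, x ^ r = x * x ^ (r - 1) := fun x => by
    nth_rw 2 [← ENNReal.rpow_one x]
    rw [← ENNReal.rpow_add_of_nonneg _ _ zero_le_one (by linarith)]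
    ring_nf
  calc ∑' i, a i ^ r ≤ ∑' i, a i * (∑' i, a i) ^ (r - 1) := by
        refine ENNReal.tsum_le_tsum fun i => ?_
        rw [h]
        exact mul_le_mul' le_rfl (ENNReal.rpow_le_rpow (ENNReal.le_tsum i) (by linarith))
    _ = (∑' i, a i) ^ r := by rw [ENNReal.tsum_mul_right, ← h]

/-- Hölder's inequality against the constant function `1`. -/
theorem lintegral_rpow_le {α : Type*} [MeasurableSpace α] (μ : Measure α) {r : ℝ} (hr : 1 ≤ r)
    {F : α → ℝ≥0∞} (hF : AEMeasurable F μ) :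
    (∫⁻ x, F x ∂μ) ^ r ≤ μ Set.univ ^ (r - 1) * ∫⁻ x, F x ^ r ∂μ := by
  rcases hr.eq_or_lt with rfl | hr
  · simp
  have hc := Real.HolderConjugate.conjExponent hr
  have h := ENNReal.lintegral_mul_le_Lp_mul_Lq μ hc hF (g := fun _ => 1) aemeasurable_const
  simp only [Pi.mul_apply, mul_one, ENNReal.one_rpow, lintegral_one] at h
  calc (∫⁻ x, F x ∂μ) ^ r
      ≤ ((∫⁻ x, F x ^ r ∂μ) ^ (1 / r) * μ Set.univ ^ (1 / r.conjExponent)) ^ r := by gcongr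
    _ = _ := by
        rw [ENNReal.mul_rpow_of_nonneg _ _ (by linarith), ← ENNReal.rpow_mul,
          ← ENNReal.rpow_mul, one_div_mul_cancel (by linarith), ENNReal.rpow_one, mul_comm]
        congr 2
        rw [Real.conjExponent]
        field_simp

theorem two_rpow_add (x y : ℝ) : (2 : ℝ≥0∞) ^ (x + y) = 2 ^ x * 2 ^ y :=
  ENNReal.rpow_add _ _ (by norm_num) (by norm_num)

theorem two_rpow_ne_top (x : ℝ) : (2 : ℝ≥0∞) ^ x ≠ ∞ := by
  simp [ENNReal.rpow_eq_top_iff]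

/-- The sum of the geometric series of ratio `2 ^ (-a)`. -/
noncomputable def geomConst (a : ℝ) : ℝ≥0∞ := (1 - 2 ^ (-a))⁻¹

theorem geomConst_ne_top {a : ℝ} (ha : 0 < a) : geomConst a ≠ ∞ := by
  rw [geomConst, Ne, ENNReal.inv_eq_top, tsub_eq_zero_iff_le, not_le]
  exact ENNReal.rpow_lt_one_of_one_lt_of_neg (by norm_num) (by linarith)

/-- The geometric sum of `2^{ja}` over the scales `2^j ≤ x`. -/
theorem tsum_two_rpow_le {a : ℝ} (ha : 0 < a) (x : ℝ≥0∞) :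
    ∑' j : ℤ, (if (2 : ℝ≥0∞) ^ (j : ℝ) ≤ x then (2 : ℝ≥0∞) ^ ((j : ℝ) * a) else 0) ≤
      geomConst a * x ^ a := by
  rcases eq_or_ne x 0 with rfl | h0
  · have h : ∀ j : ℤ, ¬ (2 : ℝ≥0∞) ^ (j : ℝ) ≤ 0 := fun j =>
      (ENNReal.rpow_pos (by norm_num) (by norm_num)).not_ge
    simp only [h, if_false, tsum_zero, zero_le]
  rcases eq_or_ne x ∞ with rfl | ht
  · have : geomConst a ≠ 0 := by
      rw [geomConst, Ne, ENNReal.inv_eq_zero]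
      exact ENNReal.sub_ne_top ENNReal.one_ne_top
    rw [ENNReal.top_rpow_of_pos ha, ENNReal.mul_top this]
    exact le_top
  have hxr : 0 < x.toReal := ENNReal.toReal_pos h0 ht
  set J : ℤ := ⌊Real.logb 2 x.toReal⌋ with hJ
  have hiff : ∀ j : ℤ, (2 : ℝ≥0∞) ^ (j : ℝ) ≤ x ↔ j ≤ J := by
    intro j
    rw [hJ, Int.le_floor, Real.le_logb_iff_rpow_le (by norm_num) hxr,
      ← ENNReal.ofReal_le_iff_le_toReal ht, ← ENNReal.ofReal_rpow_of_pos (by norm_num)]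
    simp
  have hinj : Function.Injective (fun n : ℕ => J - (n : ℤ)) := by
    intro m n h
    have : J - (m : ℤ) = J - n := h
    omega
  rw [← hinj.tsum_eq]
  swap
  · intro j hj
    have : j ≤ J := by
      by_contra h
      rw [Function.mem_support, if_neg (by rwa [hiff])] at hj
      exact hj rfl
    exact ⟨(J - j).toNat, by simp; omega⟩
  calc ∑' n : ℕ, (if (2 : ℝ≥0∞) ^ ((J - (n : ℤ) : ℤ) : ℝ) ≤ x then
        (2 : ℝ≥0∞) ^ (((J - (n : ℤ) : ℤ) : ℝ) * a) else 0)
      = ∑' n : ℕ, 2 ^ ((J : ℝ) * a) * ((2 : ℝ≥0∞) ^ (-a)) ^ n := by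
        congr 1 with n
        rw [if_pos ((hiff _).2 (by omega)), ← ENNReal.rpow_natCast, ← ENNReal.rpow_mul,
          ← two_rpow_add]
        congr 1
        push_cast
        ring
    _ = geomConst a * (2 ^ (J : ℝ)) ^ a := by
        rw [ENNReal.tsum_mul_left, ENNReal.tsum_geometric, ← ENNReal.rpow_mul, mul_comm, geomConst]
    _ ≤ _ := by
        gcongr
        exact (hiff J).2 le_rfl

/-- The geometric sum of `2^{-ja}` over the scales `2^{-j} ≤ x`. -/
theorem tsum_two_rpow_neg_le {a : ℝ} (ha : 0 < a) (x : ℝ≥0∞) :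
    ∑' j : ℤ, (if (2 : ℝ≥0∞) ^ (-(j : ℝ)) ≤ x then (2 : ℝ≥0∞) ^ (-((j : ℝ) * a)) else 0) ≤
      geomConst a * x ^ a := by
  refine le_trans (le_of_eq ?_) (tsum_two_rpow_le ha x)
  rw [← (Equiv.neg ℤ).tsum_eq]
  simp

end ENNRealLemmas

/-! ### Sums over dyadic cubes -/

section Boxes

variable {d : ℕ}

/-- The cube `2^j (k + [-1, 1]^d)`, which contains the support of `ψ_{j,k}`. -/
def dyadicBox (j : ℤ) (k : Fin d → ℤ) : Set (EuclideanSpace ℝ (Fin d)) :=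
  {ξ | ∀ i, |(2 : ℝ) ^ (-j) * ξ i - k i| ≤ 1}

theorem measurableSet_dyadicBox (j : ℤ) (k : Fin d → ℤ) : MeasurableSet (dyadicBox j k) := by
  have : dyadicBox j k = ⋂ i, {ξ | |(2 : ℝ) ^ (-j) * ξ i - k i| ≤ 1} := by
    ext ξ; simp [dyadicBox]
  rw [this]
  refine MeasurableSet.iInter fun i => measurableSet_le (by fun_prop) (by fun_prop)

/-- The volume of the cube `[-1, 1]^d`. -/
noncomputable def boxVolume (d : ℕ) : ℝ≥0∞ :=
  volume (dyadicBox 0 0 : Set (EuclideanSpace ℝ (Fin d)))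

theorem volume_dyadicBox (j : ℤ) (k : Fin d → ℤ) :
    volume (dyadicBox j k) = 2 ^ ((j : ℝ) * d) * boxVolume d := by
  have h : dyadicBox j k = (fun ξ : EuclideanSpace ℝ (Fin d) => (2 : ℝ) ^ (-j) • ξ) ⁻¹'
      ((fun ξ => ξ + -WithLp.toLp 2 (fun i => (k i : ℝ))) ⁻¹' dyadicBox 0 0) := by
    ext ξ; simp [dyadicBox, sub_eq_add_neg]
  rw [h, Measure.addHaar_preimage_smul _ (by positivity), measure_preimage_add_right, boxVolume]
  congr 1
  rw [finrank_euclideanSpace_fin, abs_of_pos (by positivity), ENNReal.rpow_mul,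
    ENNReal.rpow_natCast, ← inv_pow, ← zpow_neg, neg_neg, ENNReal.ofReal_pow (by positivity),
    ← Real.rpow_intCast,
    ← ENNReal.ofReal_rpow_of_pos (by norm_num)]
  simp

theorem dyadicBox_subset_closedBall (j : ℤ) (k : Fin d → ℤ) :
    dyadicBox j k ⊆ Metric.closedBall (WithLp.toLp 2 (fun i => (2 : ℝ) ^ j * (k i : ℝ)))
      (d * (2 : ℝ) ^ j) := by
  intro ξ hξ
  rw [Metric.mem_closedBall, dist_eq_norm, EuclideanSpace.norm_eq]
  have h2 : (0 : ℝ) < (2 : ℝ) ^ j := by positivity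
  have hi : ∀ i, ‖(ξ - WithLp.toLp 2 (fun i => (2 : ℝ) ^ j * (k i : ℝ))) i‖ ^ 2 ≤
      ((2 : ℝ) ^ j) ^ 2 := by
    intro i
    gcongr
    have h := hξ i
    have e : (ξ - WithLp.toLp 2 (fun i => (2 : ℝ) ^ j * (k i : ℝ))) i =
        (2 : ℝ) ^ j * ((2 : ℝ) ^ (-j) * ξ i - k i) := by
      simp [zpow_neg]; field_simp
    rw [e, norm_mul, Real.norm_eq_abs, Real.norm_eq_abs, abs_of_pos h2]
    nlinarith
  calc √(∑ i, ‖(ξ - WithLp.toLp 2 (fun i => (2 : ℝ) ^ j * (k i : ℝ))) i‖ ^ 2)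
      ≤ √((d * (2 : ℝ) ^ j) ^ 2) := by
        apply Real.sqrt_le_sqrt
        refine (Finset.sum_le_sum fun i _ => hi i).trans ?_
        rw [Finset.sum_const, Finset.card_univ, Fintype.card_fin, nsmul_eq_mul, mul_pow]
        gcongr
        exact_mod_cast Nat.le_self_pow (by norm_num) d
    _ = _ := Real.sqrt_sq (by positivity)

theorem boxVolume_ne_top (d : ℕ) : boxVolume d ≠ ∞ :=
  ((measure_mono (dyadicBox_subset_closedBall 0 0)).trans_lt measure_closedBall_lt_top).ne

/-- Every point lies in at most `3^d` of the cubes of a given scale. -/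
theorem tsum_lintegral_dyadicBox_le (j : ℤ) {F : EuclideanSpace ℝ (Fin d) → ℝ≥0∞}
    (hF : Measurable F) :
    ∑' k : Fin d → ℤ, ∫⁻ ξ in dyadicBox j k, F ξ ≤ 3 ^ d * ∫⁻ ξ, F ξ := by
  classical
  simp only [← lintegral_indicator (measurableSet_dyadicBox j _)]
  rw [← lintegral_tsum fun k => (hF.indicator (measurableSet_dyadicBox j k)).aemeasurable,
    ← lintegral_const_mul _ hF]
  gcongr with ξ
  set K : Finset (Fin d → ℤ) := Fintype.piFinset fun i =>
    Finset.Icc (⌈(2 : ℝ) ^ (-j) * ξ i⌉ - 1) (⌈(2 : ℝ) ^ (-j) * ξ i⌉ + 1) with hK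
  have hcard : K.card = 3 ^ d := by
    rw [hK, Fintype.card_piFinset]
    have : ∀ i : Fin d, (Finset.Icc (⌈(2 : ℝ) ^ (-j) * ξ i⌉ - 1)
        (⌈(2 : ℝ) ^ (-j) * ξ i⌉ + 1)).card = 3 := by
      intro i
      rw [Int.card_Icc]
      omega
    rw [Finset.prod_congr rfl fun i _ => this i]
    simp
  rw [tsum_eq_sum (s := K)]
  · calc ∑ k ∈ K, (dyadicBox j k).indicator F ξ ≤ ∑ _k ∈ K, F ξ :=
          Finset.sum_le_sum fun k _ => Set.indicator_le_self _ _ _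
      _ = 3 ^ d * F ξ := by rw [Finset.sum_const, hcard]; simp
  · intro k hk
    apply Set.indicator_of_notMem
    intro hmem
    apply hk
    rw [hK, Fintype.mem_piFinset]
    intro i
    have h := abs_le.1 (hmem i)
    have h1 := Int.le_ceil ((2 : ℝ) ^ (-j) * ξ i)
    have h2 := Int.ceil_lt_add_one ((2 : ℝ) ^ (-j) * ξ i)
    rw [Finset.mem_Icc]
    constructor
    · have : ((⌈(2 : ℝ) ^ (-j) * ξ i⌉ - 2 : ℤ) : ℝ) < (k i : ℝ) := by push_cast; linarith
      have := Int.cast_lt.1 this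
      omega
    · have : (k i : ℝ) ≤ ((⌈(2 : ℝ) ^ (-j) * ξ i⌉ + 1 : ℤ) : ℝ) := by push_cast; linarith
      exact Int.cast_le.1 this

/-- The sharp-cutoff version of the `q`-th power of the norm of `X_{s,q}`, with the window
`ψ_{j,k}` replaced by the indicator of `dyadicBox j k`. -/
noncomputable def boxSum (s q : ℝ) (u : EuclideanSpace ℝ (Fin d) → ℝ≥0∞) : ℝ≥0∞ :=
  ∑' j : ℤ, (2 : ℝ≥0∞) ^ ((j : ℝ) * d * ((s - 2) / (2 * s)) * q) *
    ∑' k : Fin d → ℤ, (∫⁻ ξ in dyadicBox j k, u ξ ^ s) ^ (q / s)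

theorem mem_dyadicBox_of_psiJK_ne_zero {ψ : 𝓢(EuclideanSpace ℝ (Fin d), ℂ)}
    (hψ : IsUniformWindow ψ) {j : ℤ} {k : Fin d → ℤ} {ξ : EuclideanSpace ℝ (Fin d)}
    (h : psiJK ψ j k ξ ≠ 0) : ξ ∈ dyadicBox j k := by
  intro i
  have := hψ.1 (subset_tsupport _ (Function.mem_support.2 h)) i
  rw [abs_le]
  simpa using this

theorem xNorm_le_boxSum {ψ : 𝓢(EuclideanSpace ℝ (Fin d), ℂ)} (hψ : IsUniformWindow ψ)
    {A : ℝ≥0} (hA : ∀ ξ, ‖ψ ξ‖₊ ≤ A) {s q : ℝ} (hs : 0 < s) (hq : 0 < q)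
    {u : 𝓢'(EuclideanSpace ℝ (Fin d), ℂ)} {f : EuclideanSpace ℝ (Fin d) → ℂ}
    (hf : AEStronglyMeasurable f volume)
    (hu : ∀ φ : 𝓢(EuclideanSpace ℝ (Fin d), ℂ), u φ = ∫ x, φ x * f x) :
    xNorm ψ s q u ≤ A * boxSum s q (fun ξ => ‖f ξ‖ₑ) ^ (1 / q) := by
  have hjk : ∀ j k, distLpNorm s (TemperedDistribution.smulLeftCLM ℂ (psiJK ψ j k) u) ≤
      A * (∫⁻ ξ in dyadicBox j k, ‖f ξ‖ₑ ^ s) ^ (1 / s) := by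
    intro j k
    have hcont : Continuous (psiJK ψ j k) := by unfold psiJK; fun_prop
    refine (distLpNorm_le (g := fun ξ => psiJK ψ j k ξ * f ξ)
      (hcont.aestronglyMeasurable.mul hf) fun φ => ?_).trans ?_
    · rw [TemperedDistribution.smulLeftCLM_apply_apply, hu]
      congr 1 with x
      rw [SchwartzMap.smulLeftCLM_apply_apply (hasTemperateGrowth_psiJK ψ j k), smul_eq_mul]
      ring
    · rw [eLpNorm_ofReal hs, ← lintegral_indicator (measurableSet_dyadicBox j k)]
      have hAs : (A : ℝ≥0∞) ^ s ≠ ∞ := ENNReal.rpow_ne_top_of_nonneg hs.le ENNReal.coe_ne_top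
      calc (∫⁻ ξ, ‖psiJK ψ j k ξ * f ξ‖ₑ ^ s) ^ (1 / s)
          ≤ (∫⁻ ξ, (A : ℝ≥0∞) ^ s *
            (dyadicBox j k).indicator (fun ξ => ‖f ξ‖ₑ ^ s) ξ) ^ (1 / s) := by
            gcongr with ξ
            by_cases h : psiJK ψ j k ξ = 0
            · simp [h, hs]
            · rw [Set.indicator_of_mem (mem_dyadicBox_of_psiJK_ne_zero hψ h), enorm_mul,
                ENNReal.mul_rpow_of_nonneg _ _ hs.le]
              gcongr
              exact ENNReal.coe_le_coe.2 (hA _)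
        _ = _ := by
            rw [lintegral_const_mul' _ _ hAs, ENNReal.mul_rpow_of_nonneg _ _ (by positivity),
              ← ENNReal.rpow_mul, mul_one_div_cancel hs.ne', ENNReal.rpow_one]
  have hAq : (A : ℝ≥0∞) = ((A : ℝ≥0∞) ^ q) ^ (1 / q) := by
    rw [← ENNReal.rpow_mul, mul_one_div_cancel hq.ne', ENNReal.rpow_one]
  rw [xNorm, boxSum]
  nth_rw 1 [hAq]
  rw [← ENNReal.mul_rpow_of_nonneg _ _ (by positivity), ← ENNReal.tsum_mul_left]
  refine ENNReal.rpow_le_rpow (ENNReal.tsum_le_tsum fun j => ?_) (by positivity)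
  rw [mul_left_comm, ← ENNReal.tsum_mul_left (a := (A : ℝ≥0∞) ^ q)]
  refine mul_le_mul' le_rfl (ENNReal.tsum_le_tsum fun k => ?_)
  calc _ ≤ (A * (∫⁻ ξ in dyadicBox j k, ‖f ξ‖ₑ ^ s) ^ (1 / s)) ^ q := by
        gcongr; exact hjk j k
    _ = _ := by
        rw [ENNReal.mul_rpow_of_nonneg _ _ hq.le, ← ENNReal.rpow_mul]
        ring_nf

/-! ### The bound on `L^2` -/

/-- On each cube, `u` is split along `A`. Over the cubes of one scale, the part on `A` is summed by
`ℓ^1 ⊂ ℓ^{q/s}`, and Hölder's inequality bounds the part off `A` by the integral of `u ^ q`. -/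
theorem tsum_lintegral_dyadicBox_rpow_le {s q : ℝ} (hs : 0 < s) (hsq : s ≤ q) (j : ℤ)
    {u : EuclideanSpace ℝ (Fin d) → ℝ≥0∞} (hu : Measurable u)
    {A : Set (EuclideanSpace ℝ (Fin d))} (hA : MeasurableSet A) :
    ∑' k : Fin d → ℤ, (∫⁻ ξ in dyadicBox j k, u ξ ^ s) ^ (q / s) ≤
      2 ^ (q / s - 1) * ((3 ^ d * ∫⁻ ξ in A, u ξ ^ s) ^ (q / s) +
        (2 ^ ((j : ℝ) * d) * boxVolume d) ^ (q / s - 1) * (3 ^ d * ∫⁻ ξ in Aᶜ, u ξ ^ q)) := by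
  have hr : 1 ≤ q / s := by rwa [le_div_iff₀ hs, one_mul]
  have hus : Measurable fun ξ => u ξ ^ s := hu.pow_const s
  have huq : Measurable fun ξ => u ξ ^ q := hu.pow_const q
  set F : EuclideanSpace ℝ (Fin d) → ℝ≥0∞ := A.indicator fun ξ => u ξ ^ s
  set G : EuclideanSpace ℝ (Fin d) → ℝ≥0∞ := Aᶜ.indicator fun ξ => u ξ ^ s
  have hF : Measurable F := hus.indicator hA
  have hG : Measurable G := hus.indicator hA.compl
  have hGr : ∀ ξ, G ξ ^ (q / s) = Aᶜ.indicator (fun ξ => u ξ ^ q) ξ := by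
    intro ξ
    by_cases h : ξ ∈ Aᶜ
    · simp only [G, Set.indicator_of_mem h, ← ENNReal.rpow_mul]
      rw [mul_div_cancel₀ _ hs.ne']
    · simp only [G, Set.indicator_of_notMem h]
      exact ENNReal.zero_rpow_of_pos (by linarith)
  have hsplit : ∀ k, ∫⁻ ξ in dyadicBox j k, u ξ ^ s =
      (∫⁻ ξ in dyadicBox j k, F ξ) + ∫⁻ ξ in dyadicBox j k, G ξ := by
    intro k
    rw [← lintegral_add_left hF]
    congr 1 with ξ
    exact (Set.indicator_self_add_compl_apply A (fun ξ => u ξ ^ s) ξ).symm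
  have h1 : ∑' k : Fin d → ℤ, (∫⁻ ξ in dyadicBox j k, F ξ) ^ (q / s) ≤
      (3 ^ d * ∫⁻ ξ in A, u ξ ^ s) ^ (q / s) := by
    refine (tsum_rpow_le_rpow_tsum hr _).trans (ENNReal.rpow_le_rpow ?_ (by linarith))
    rw [← lintegral_indicator hA]
    exact tsum_lintegral_dyadicBox_le j hF
  have h2 : ∑' k : Fin d → ℤ, (∫⁻ ξ in dyadicBox j k, G ξ) ^ (q / s) ≤
      (2 ^ ((j : ℝ) * d) * boxVolume d) ^ (q / s - 1) * (3 ^ d * ∫⁻ ξ in Aᶜ, u ξ ^ q) := by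
    calc ∑' k : Fin d → ℤ, (∫⁻ ξ in dyadicBox j k, G ξ) ^ (q / s)
        ≤ ∑' k : Fin d → ℤ, (2 ^ ((j : ℝ) * d) * boxVolume d) ^ (q / s - 1) *
          ∫⁻ ξ in dyadicBox j k, Aᶜ.indicator (fun ξ => u ξ ^ q) ξ := by
          refine ENNReal.tsum_le_tsum fun k => ?_
          refine (lintegral_rpow_le _ hr hG.aemeasurable).trans_eq ?_
          rw [Measure.restrict_apply_univ, volume_dyadicBox]
          simp only [hGr]
      _ ≤ _ := by
          rw [ENNReal.tsum_mul_left, ← lintegral_indicator hA.compl]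
          gcongr
          exact tsum_lintegral_dyadicBox_le j (huq.indicator hA.compl)
  calc ∑' k : Fin d → ℤ, (∫⁻ ξ in dyadicBox j k, u ξ ^ s) ^ (q / s)
      ≤ ∑' k : Fin d → ℤ, 2 ^ (q / s - 1) * ((∫⁻ ξ in dyadicBox j k, F ξ) ^ (q / s) +
          (∫⁻ ξ in dyadicBox j k, G ξ) ^ (q / s)) := by
        refine ENNReal.tsum_le_tsum fun k => ?_
        rw [hsplit]
        exact ENNReal.rpow_add_le_mul_rpow_add_rpow _ _ hr
    _ ≤ _ := by
        rw [ENNReal.tsum_mul_left, ENNReal.tsum_add]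
        gcongr

/-- The constant in the bound of `boxSum` by splitting along a set at each scale. -/
noncomputable def splitConst (d : ℕ) (s q : ℝ) : ℝ≥0∞ :=
  2 ^ (q / s - 1) * ((3 ^ d) ^ (q / s) + boxVolume d ^ (q / s - 1) * 3 ^ d)

theorem splitConst_ne_top {s q : ℝ} (hs : 0 < s) (hsq : s ≤ q) : splitConst d s q ≠ ∞ := by
  have hr : 0 ≤ q / s - 1 := by rw [sub_nonneg, le_div_iff₀ hs]; linarith
  have h3 : (3 : ℝ≥0∞) ^ d ≠ ∞ := ENNReal.pow_ne_top (by norm_num)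
  refine ENNReal.mul_ne_top (ENNReal.rpow_ne_top_of_nonneg hr (by norm_num))
    (ENNReal.add_ne_top.2 ⟨ENNReal.rpow_ne_top_of_nonneg (by linarith) h3,
      ENNReal.mul_ne_top (ENNReal.rpow_ne_top_of_nonneg hr (boxVolume_ne_top d)) h3⟩)

/-- At the scale `2^j`, the function is split along a set `A j` at will. -/
theorem boxSum_le_of_split {s q : ℝ} (hs : 0 < s) (hsq : s ≤ q)
    {u : EuclideanSpace ℝ (Fin d) → ℝ≥0∞} (hu : Measurable u)
    {A : ℤ → Set (EuclideanSpace ℝ (Fin d))} (hA : ∀ j, MeasurableSet (A j)) :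
    boxSum s q u ≤ splitConst d s q *
      (∑' j : ℤ, (2 ^ ((j : ℝ) * (d * (s / 2 - 1))) * ∫⁻ ξ in A j, u ξ ^ s) ^ (q / s) +
        ∑' j : ℤ, 2 ^ ((j : ℝ) * (d * (q / 2 - 1))) * ∫⁻ ξ in (A j)ᶜ, u ξ ^ q) := by
  have hr : 0 ≤ q / s - 1 := by rw [sub_nonneg, le_div_iff₀ hs]; linarith
  rw [boxSum, ← ENNReal.tsum_add, ← ENNReal.tsum_mul_left]
  refine ENNReal.tsum_le_tsum fun j => ?_
  refine (mul_le_mul' le_rfl (tsum_lintegral_dyadicBox_rpow_le hs hsq j hu (hA j))).trans ?_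
  set X := ∫⁻ ξ in A j, u ξ ^ s
  set Y := ∫⁻ ξ in (A j)ᶜ, u ξ ^ q
  have e1 : (2 : ℝ≥0∞) ^ ((j : ℝ) * d * ((s - 2) / (2 * s)) * q) * (3 ^ d * X) ^ (q / s) =
      (3 ^ d) ^ (q / s) * (2 ^ ((j : ℝ) * (d * (s / 2 - 1))) * X) ^ (q / s) := by
    rw [ENNReal.mul_rpow_of_nonneg _ _ (by linarith), ENNReal.mul_rpow_of_nonneg _ _ (by linarith),
      ← ENNReal.rpow_mul 2, mul_left_comm]
    congr 3
    field_simp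
  have e2 : (2 : ℝ≥0∞) ^ ((j : ℝ) * d * ((s - 2) / (2 * s)) * q) *
      ((2 ^ ((j : ℝ) * d) * boxVolume d) ^ (q / s - 1) * (3 ^ d * Y)) =
      boxVolume d ^ (q / s - 1) * 3 ^ d * (2 ^ ((j : ℝ) * (d * (q / 2 - 1))) * Y) := by
    rw [ENNReal.mul_rpow_of_nonneg _ _ hr, ← ENNReal.rpow_mul 2]
    have : (j : ℝ) * (d * (q / 2 - 1)) =
        (j : ℝ) * d * ((s - 2) / (2 * s)) * q + (j : ℝ) * d * (q / s - 1) := by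
      field_simp; ring
    rw [this, two_rpow_add]
    ring
  rw [mul_left_comm, mul_add, e1, e2, splitConst]
  refine le_trans (mul_le_mul' le_rfl ?_) (mul_assoc _ _ _).ge
  rw [add_mul, mul_add, mul_add]
  gcongr
  · exact le_self_add
  · exact le_add_self

theorem tsum_mul_setLIntegral_eq {α : Type*} [MeasurableSpace α] {μ : Measure α}
    {F : α → ℝ≥0∞} (hF : Measurable F) (c : ℤ → ℝ≥0∞) {B : ℤ → Set α}
    (hB : ∀ j, MeasurableSet (B j)) :
    ∑' j : ℤ, c j * ∫⁻ ξ in B j, F ξ ∂μ =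
      ∫⁻ ξ, F ξ * ∑' j : ℤ, (B j).indicator (fun _ => c j) ξ ∂μ := by
  have hm : ∀ j, Measurable fun ξ => F ξ * (B j).indicator (fun _ => c j) ξ := fun j =>
    hF.mul (measurable_const.indicator (hB j))
  simp only [← ENNReal.tsum_mul_left]
  rw [lintegral_tsum fun j => (hm j).aemeasurable]
  congr 1 with j
  rw [← lintegral_const_mul _ hF, ← lintegral_indicator (hB j)]
  congr 1 with ξ
  by_cases h : ξ ∈ B j
  · simp [h, mul_comm]
  · simp [h]

/-- Splitting at the scale `2^j` along `A j = {u ≥ 2^{-jd/2}}`. For fixed `ξ` both sums over `j` are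
geometric, with values comparable to `u(ξ)^2`. -/
theorem boxSum_le_of_lintegral_sq (hd : 0 < d) {s q : ℝ} (hs : 0 < s) (hs2 : s < 2) (hq : 2 < q)
    {u : EuclideanSpace ℝ (Fin d) → ℝ≥0∞} (hu : Measurable u) :
    boxSum s q u ≤ splitConst d s q *
      ((geomConst (d * (1 - s / 2)) * ∫⁻ ξ, u ξ ^ (2 : ℝ)) ^ (q / s) +
        geomConst (d * (q / 2 - 1)) * ∫⁻ ξ, u ξ ^ (2 : ℝ)) := by
  have hd' : (0 : ℝ) < d := Nat.cast_pos.2 hd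
  have hr : 1 ≤ q / s := by rw [le_div_iff₀ hs]; linarith
  -- the threshold `u ≥ 2^{-jd/2}`
  set A : ℤ → Set (EuclideanSpace ℝ (Fin d)) := fun j =>
    {ξ | (2 : ℝ≥0∞) ^ (-(j : ℝ)) ≤ u ξ ^ (2 / (d : ℝ))} with hAdef
  have hA : ∀ j, MeasurableSet (A j) := fun j =>
    measurableSet_le measurable_const (hu.pow_const _)
  refine (boxSum_le_of_split hs (by linarith) hu hA).trans ?_
  gcongr
  · refine (tsum_rpow_le_rpow_tsum hr _).trans (ENNReal.rpow_le_rpow ?_ (by linarith))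
    rw [tsum_mul_setLIntegral_eq (hu.pow_const s) _ hA, ← lintegral_const_mul _ (hu.pow_const _)]
    refine lintegral_mono fun ξ => ?_
    have ha : 0 < d * (1 - s / 2) := mul_pos hd' (by linarith)
    have h := tsum_two_rpow_neg_le ha (u ξ ^ (2 / (d : ℝ)))
    have he : (u ξ ^ (2 / (d : ℝ))) ^ (d * (1 - s / 2)) = u ξ ^ (2 - s) := by
      rw [← ENNReal.rpow_mul]; congr 1; field_simp
    rw [he] at h
    calc _ ≤ u ξ ^ s * (geomConst (d * (1 - s / 2)) * u ξ ^ (2 - s)) := by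
          gcongr
          refine le_trans (le_of_eq ?_) h
          congr 1 with j
          simp only [hAdef, Set.indicator_apply, Set.mem_ofPred_eq]
          congr 2
          ring
      _ = _ := by
          rw [mul_left_comm, ← ENNReal.rpow_add_of_nonneg _ _ hs.le (by linarith)]
          ring_nf
  · rw [tsum_mul_setLIntegral_eq (hu.pow_const q) _ fun j => (hA j).compl,
      ← lintegral_const_mul _ (hu.pow_const _)]
    refine lintegral_mono fun ξ => ?_
    beta_reduce
    rcases eq_or_ne (u ξ) 0 with h0 | h0
    · rw [h0, ENNReal.zero_rpow_of_pos (by linarith)]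
      simp
    rcases eq_or_ne (u ξ) ∞ with ht | ht
    · have h1 : ∀ j : ℤ, (A j)ᶜ.indicator
          (fun _ => (2 : ℝ≥0∞) ^ ((j : ℝ) * (d * (q / 2 - 1)))) ξ = 0 := by
        intro j
        apply Set.indicator_of_notMem
        rw [Set.mem_compl_iff, not_not]
        simp only [hAdef, Set.mem_ofPred_eq, ht]
        rw [ENNReal.top_rpow_of_pos (by positivity)]
        exact le_top
      simp only [h1, tsum_zero, mul_zero, zero_le]
    have hb : 0 < d * (q / 2 - 1) := mul_pos hd' (by linarith)
    have h := tsum_two_rpow_le hb ((u ξ ^ (2 / (d : ℝ)))⁻¹)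
    have he : ((u ξ ^ (2 / (d : ℝ)))⁻¹) ^ (d * (q / 2 - 1)) = u ξ ^ (2 - q) := by
      rw [← ENNReal.rpow_neg, ← ENNReal.rpow_mul]; congr 1; field_simp; ring
    rw [he] at h
    calc _ ≤ u ξ ^ q * (geomConst (d * (q / 2 - 1)) * u ξ ^ (2 - q)) := by
          gcongr
          refine le_trans (ENNReal.tsum_le_tsum fun j => ?_) h
          by_cases hj : ξ ∈ (A j)ᶜ
          · rw [Set.indicator_of_mem hj, if_pos]
            simp only [hAdef, Set.mem_compl_iff, Set.mem_ofPred_eq, not_le] at hj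
            rw [← inv_inv ((2 : ℝ≥0∞) ^ (j : ℝ)), ← ENNReal.rpow_neg]
            exact ENNReal.inv_le_inv.2 hj.le
          · rw [Set.indicator_of_notMem hj]
            exact zero_le
      _ = _ := by
          rw [mul_left_comm, ← ENNReal.rpow_add _ _ h0 ht]
          ring_nf

theorem boxSum_const_mul {s q : ℝ} (hs : 0 < s) (hq : 0 < q) {c : ℝ≥0∞} (hc : c ≠ ∞)
    (u : EuclideanSpace ℝ (Fin d) → ℝ≥0∞) :
    boxSum s q (fun ξ => c * u ξ) = c ^ q * boxSum s q u := by
  have hcs : c ^ s ≠ ∞ := ENNReal.rpow_ne_top_of_nonneg hs.le hc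
  simp only [boxSum, ENNReal.mul_rpow_of_nonneg _ _ hs.le, lintegral_const_mul' _ _ hcs,
    ENNReal.mul_rpow_of_nonneg _ _ (div_pos hq hs).le, ← ENNReal.rpow_mul,
    mul_div_cancel₀ _ hs.ne', ← ENNReal.tsum_mul_left]
  congr 1 with j
  congr 1 with k
  ring

/-- The embedding `L^2 ⊂ X_{s,q}`. The bound of `boxSum` is not homogeneous, so it is applied to
functions of norm one. -/
theorem exists_xNorm_le (hd : 0 < d) {ψ : 𝓢(EuclideanSpace ℝ (Fin d), ℂ)}
    (hψ : IsUniformWindow ψ) {s q : ℝ} (hs : 1 ≤ s) (hs2 : s < 2) (hq : 2 < q) :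
    ∃ C : ℝ≥0, ∀ f : Lp ℂ 2 (volume : Measure (EuclideanSpace ℝ (Fin d))),
      xNorm ψ s q (f : 𝓢'(EuclideanSpace ℝ (Fin d), ℂ)) ≤ C * ‖f‖ₑ := by
  obtain ⟨B, hB⟩ : ∃ B : ℝ≥0, ∀ ξ, ‖ψ ξ‖₊ ≤ B :=
    ⟨‖ψ.toBoundedContinuousFunction‖₊, fun ξ =>
      ψ.toBoundedContinuousFunction.nnnorm_coe_le_nnnorm ξ⟩
  set K : ℝ≥0∞ := splitConst d s q * (geomConst (d * (1 - s / 2)) ^ (q / s) +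
    geomConst (d * (q / 2 - 1))) with hK
  have hd' : (0 : ℝ) < d := Nat.cast_pos.2 hd
  have hKt : K ≠ ∞ := ENNReal.mul_ne_top (splitConst_ne_top (by linarith) (by linarith))
    (ENNReal.add_ne_top.2 ⟨ENNReal.rpow_ne_top_of_nonneg (by positivity)
      (geomConst_ne_top (mul_pos hd' (by linarith))),
      geomConst_ne_top (mul_pos hd' (by linarith))⟩)
  have hKq : K ^ (1 / q) ≠ ∞ := ENNReal.rpow_ne_top_of_nonneg (by positivity) hKt
  refine ⟨B * (K ^ (1 / q)).toNNReal, fun f => ?_⟩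
  have hx := xNorm_le_boxSum hψ hB (s := s) (q := q) (by linarith) (by linarith)
    (u := (f : 𝓢'(EuclideanSpace ℝ (Fin d), ℂ))) (Lp.memLp f).1 fun φ => by
      rw [Lp.toTemperedDistribution_apply]; rfl
  refine hx.trans ?_
  rw [ENNReal.coe_mul, ENNReal.coe_toNNReal hKq, mul_assoc]
  gcongr
  set N : ℝ≥0∞ := ‖f‖ₑ with hN
  have hNt : N ≠ ∞ := enorm_ne_top
  have hint : ∫⁻ ξ, ‖f ξ‖ₑ ^ (2 : ℝ) = N ^ (2 : ℝ) := by
    rw [hN, Lp.enorm_def, eLpNorm_eq_lintegral_rpow_enorm_toReal two_ne_zero ENNReal.ofNat_ne_top,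
      ← ENNReal.rpow_mul]
    simp
  have hmeas : Measurable fun ξ => ‖f ξ‖ₑ := (Lp.stronglyMeasurable f).measurable.enorm
  suffices h : boxSum s q (fun ξ => ‖f ξ‖ₑ) ≤ K * N ^ q by
    calc _ ≤ (K * N ^ q) ^ (1 / q) := by gcongr
      _ = _ := by
        rw [ENNReal.mul_rpow_of_nonneg _ _ (by positivity), ← ENNReal.rpow_mul,
          mul_one_div_cancel (by linarith), ENNReal.rpow_one]
  rcases eq_or_ne N 0 with h0 | h0
  · have h1 := boxSum_le_of_lintegral_sq hd (by linarith : 0 < s) hs2 hq hmeas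
    rw [hint, h0, ENNReal.zero_rpow_of_pos (by norm_num), mul_zero, mul_zero,
      ENNReal.zero_rpow_of_pos (by positivity)] at h1
    exact h1.trans (by simp)
  -- normalise to norm one
  have h1 := boxSum_le_of_lintegral_sq hd (by linarith : 0 < s) hs2 hq (hmeas.const_mul N⁻¹)
  have h2 : ∫⁻ ξ, (N⁻¹ * ‖f ξ‖ₑ) ^ (2 : ℝ) = 1 := by
    simp only [ENNReal.mul_rpow_of_nonneg _ _ (by norm_num : (0 : ℝ) ≤ 2)]
    rw [lintegral_const_mul _ (hmeas.pow_const _), hint,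
      ← ENNReal.mul_rpow_of_nonneg _ _ (by norm_num), ENNReal.inv_mul_cancel h0 hNt,
      ENNReal.one_rpow]
  rw [h2, mul_one, mul_one, ← hK] at h1
  have h3 : (fun ξ => ‖f ξ‖ₑ) = fun ξ => N * (N⁻¹ * ‖f ξ‖ₑ) := by
    ext ξ
    rw [← mul_assoc, ENNReal.mul_inv_cancel h0 hNt, one_mul]
  rw [h3, boxSum_const_mul (by linarith) (by linarith) hNt, mul_comm]
  gcongr

end Boxes

/-! ### Dyadic annuli -/

section Annuli

variable {d : ℕ}

/-- The dyadic annulus `2^{-(n+1)} < |ξ| ≤ 2^{-n}`. -/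
def annulus (d n : ℕ) : Set (EuclideanSpace ℝ (Fin d)) :=
  {ξ | (1 / 2 : ℝ) ^ (n + 1) < ‖ξ‖ ∧ ‖ξ‖ ≤ (1 / 2 : ℝ) ^ n}

theorem measurableSet_annulus (d n : ℕ) : MeasurableSet (annulus d n) :=
  (measurableSet_lt measurable_const measurable_norm).inter
    (measurableSet_le measurable_norm measurable_const)

theorem ofReal_half_pow (n : ℕ) : ENNReal.ofReal ((1 / 2 : ℝ) ^ n) = 2 ^ (-(n : ℝ)) := by
  rw [ENNReal.ofReal_pow (by norm_num), ENNReal.rpow_neg, ENNReal.rpow_natCast, one_div,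
    ENNReal.ofReal_inv_of_pos (by norm_num), ENNReal.inv_pow]
  simp

theorem volume_annulus_le (d n : ℕ) : volume (annulus d n) ≤
    2 ^ (-((n : ℝ) * d)) * volume (Metric.closedBall (0 : EuclideanSpace ℝ (Fin d)) 1) := by
  calc volume (annulus d n)
      ≤ volume (Metric.closedBall (0 : EuclideanSpace ℝ (Fin d)) ((1 / 2) ^ n)) := by
        refine measure_mono fun ξ hξ => ?_
        simpa using hξ.2
    _ = _ := by
        rw [Measure.addHaar_closedBall' _ _ (by positivity), finrank_euclideanSpace_fin,
          ENNReal.ofReal_pow (by positivity), ofReal_half_pow, ← ENNReal.rpow_natCast,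
          ← ENNReal.rpow_mul, neg_mul]

/-- The annuli cover the ball except for the origin. -/
theorem setLIntegral_closedBall_le_tsum_annulus {F : EuclideanSpace ℝ (Fin d) → ℝ≥0∞}
    (hF : F 0 = 0) (m : ℕ) :
    ∫⁻ ξ in Metric.closedBall 0 ((1 / 2) ^ m), F ξ ≤
      ∑' n : ℕ, ∫⁻ ξ in annulus d (m + n), F ξ := by
  refine le_trans ?_ (lintegral_iUnion_le _ _)
  rw [← lintegral_indicator Metric.isClosed_closedBall.measurableSet,
    ← lintegral_indicator (MeasurableSet.iUnion fun n => measurableSet_annulus d _)]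
  refine lintegral_mono fun ξ => ?_
  rcases eq_or_ne ξ 0 with rfl | h0
  · simp [hF]
  by_cases hξ : ξ ∈ Metric.closedBall 0 ((1 / 2) ^ m)
  · have hle : ‖ξ‖ ≤ (1 / 2) ^ m := by simpa using hξ
    obtain ⟨n, hn1, hn2⟩ := exists_nat_pow_near_of_lt_one (norm_pos_iff.2 h0)
      (hle.trans (pow_le_one₀ (by norm_num) (by norm_num))) (by norm_num : (0 : ℝ) < 1 / 2)
      (by norm_num)
    have hmn : m < n + 1 :=
      (pow_lt_pow_iff_right_of_lt_one₀ (by norm_num) (by norm_num)).1 (hn1.trans_le hle)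
    have hmem : ξ ∈ ⋃ n, annulus d (m + n) :=
      Set.mem_iUnion.2 ⟨n - m, by rw [Nat.add_sub_cancel' (by omega)]; exact ⟨hn1, hn2⟩⟩
    rw [Set.indicator_of_mem hξ, Set.indicator_of_mem hmem]
  · rw [Set.indicator_of_notMem hξ]
    exact zero_le

end Annuli

/-! ### The singularity of `g` at the origin -/

section LogSingular

variable {d : ℕ}

theorem measurableSet_openCube (d : ℕ) :
    MeasurableSet {ξ : EuclideanSpace ℝ (Fin d) | ∀ i, ξ i ∈ Set.Ioo (0 : ℝ) (1 / 2)} := by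
  have : {ξ : EuclideanSpace ℝ (Fin d) | ∀ i, ξ i ∈ Set.Ioo (0 : ℝ) (1 / 2)} =
      ⋂ i, (fun ξ : EuclideanSpace ℝ (Fin d) => ξ i) ⁻¹' Set.Ioo (0 : ℝ) (1 / 2) := by
    ext ξ; simp
  rw [this]
  exact MeasurableSet.iInter fun i => measurableSet_Ioo.preimage (by fun_prop)

theorem measurable_logSingular (d : ℕ) : Measurable (logSingular d) := by
  refine Measurable.indicator ?_ (measurableSet_openCube d)
  fun_prop

theorem norm_logSingular_le (ξ : EuclideanSpace ℝ (Fin d)) :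
    ‖logSingular d ξ‖ ≤ ‖ξ‖ ^ (-(d : ℝ) / 2) * |Real.log ‖ξ‖| ^ (-(1 : ℝ) / 2) := by
  refine (norm_indicator_le_norm_self _ _).trans_eq ?_
  rw [Complex.norm_real, Real.norm_eq_abs, abs_of_nonneg (by positivity)]

theorem logSingular_zero (d : ℕ) : logSingular d 0 = 0 := by
  have := norm_logSingular_le (0 : EuclideanSpace ℝ (Fin d))
  rw [norm_zero, Real.log_zero, abs_zero, Real.zero_rpow (by norm_num : -(1 : ℝ) / 2 ≠ 0),
    mul_zero] at this
  exact norm_le_zero_iff.1 this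

/-- The constant in the bound `|ξ|^{-d/2} |ln |ξ||^{-1/2} ≤ C 2^{nd/2} n^{-1/2}` on the dyadic
annulus `|ξ| ~ 2^{-n}`. -/
noncomputable def annulusConst (d : ℕ) : ℝ≥0 :=
  ((2 : ℝ) ^ ((d : ℝ) / 2) * Real.log 2 ^ (-(1 : ℝ) / 2)).toNNReal

theorem abs_log_norm_ge {n : ℕ} {ξ : EuclideanSpace ℝ (Fin d)} (hξ : ξ ∈ annulus d n) :
    n * Real.log 2 ≤ |Real.log ‖ξ‖| := by
  have hpos : 0 < ‖ξ‖ := lt_trans (by positivity) hξ.1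
  have h := Real.log_le_log hpos hξ.2
  rw [Real.log_pow, one_div, Real.log_inv] at h
  refine le_trans ?_ (neg_le_abs _)
  linarith

theorem enorm_logSingular_le {n : ℕ} (hn : 1 ≤ n) {ξ : EuclideanSpace ℝ (Fin d)}
    (hξ : ξ ∈ annulus d n) :
    ‖logSingular d ξ‖ₑ ≤ annulusConst d * (2 ^ ((n : ℝ) * (d / 2)) *
      (n : ℝ≥0∞) ^ (-(1 / 2) : ℝ)) := by
  have hpos : 0 < ‖ξ‖ := lt_trans (by positivity) hξ.1
  have hn0 : (0 : ℝ) < n := by exact_mod_cast hn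
  have hl2 : 0 < Real.log 2 := Real.log_pos (by norm_num)
  have h1 : ‖ξ‖ ^ (-(d : ℝ) / 2) ≤ (2 : ℝ) ^ (((n : ℝ) + 1) * (d / 2)) := by
    calc ‖ξ‖ ^ (-(d : ℝ) / 2) ≤ ((1 / 2 : ℝ) ^ (n + 1)) ^ (-(d : ℝ) / 2) :=
          Real.rpow_le_rpow_of_nonpos (by positivity) hξ.1.le
            (by have : (0 : ℝ) ≤ d := Nat.cast_nonneg d
                linarith)
      _ = _ := by
          rw [one_div, inv_pow, ← Real.rpow_natCast, ← Real.rpow_neg (by norm_num),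
            ← Real.rpow_mul (by norm_num)]
          congr 1
          push_cast
          ring
  have h2 : |Real.log ‖ξ‖| ^ (-(1 : ℝ) / 2) ≤ (n * Real.log 2) ^ (-(1 : ℝ) / 2) :=
    Real.rpow_le_rpow_of_nonpos (by positivity) (abs_log_norm_ge hξ) (by norm_num)
  have h3 : ‖logSingular d ξ‖ ≤ (2 : ℝ) ^ ((d : ℝ) / 2) * Real.log 2 ^ (-(1 : ℝ) / 2) *
      ((2 : ℝ) ^ ((n : ℝ) * (d / 2)) * (n : ℝ) ^ (-(1 / 2) : ℝ)) := by
    refine (norm_logSingular_le ξ).trans ((mul_le_mul h1 h2 (by positivity)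
      (by positivity)).trans_eq ?_)
    rw [Real.mul_rpow hn0.le hl2.le, add_mul, Real.rpow_add (by norm_num)]
    ring_nf
  rw [← ofReal_norm]
  refine (ENNReal.ofReal_le_ofReal h3).trans_eq ?_
  rw [ENNReal.ofReal_mul (by positivity),
    ENNReal.ofReal_mul (p := (2 : ℝ) ^ ((n : ℝ) * (d / 2))) (by positivity),
    ← ENNReal.ofReal_rpow_of_pos hn0, ← ENNReal.ofReal_rpow_of_pos (by norm_num : (0 : ℝ) < 2)]
  simp [annulusConst, ENNReal.ofReal]

theorem setLIntegral_annulus_le {n : ℕ} (hn : 1 ≤ n) {t : ℝ} (ht : 0 ≤ t) :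
    ∫⁻ ξ in annulus d n, ‖logSingular d ξ‖ₑ ^ t ≤
      annulusConst d ^ t * volume (Metric.closedBall (0 : EuclideanSpace ℝ (Fin d)) 1) *
        ((n : ℝ≥0∞) ^ (-(t / 2)) * 2 ^ (-((n : ℝ) * (d * (1 - t / 2))))) := by
  calc ∫⁻ ξ in annulus d n, ‖logSingular d ξ‖ₑ ^ t
      ≤ ∫⁻ ξ in annulus d n, (annulusConst d * (2 ^ ((n : ℝ) * (d / 2)) *
          (n : ℝ≥0∞) ^ (-(1 / 2) : ℝ))) ^ t :=
        setLIntegral_mono measurable_const fun ξ hξ =>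
          ENNReal.rpow_le_rpow (enorm_logSingular_le hn hξ) ht
    _ ≤ (annulusConst d * (2 ^ ((n : ℝ) * (d / 2)) * (n : ℝ≥0∞) ^ (-(1 / 2) : ℝ))) ^ t *
        (2 ^ (-((n : ℝ) * d)) * volume (Metric.closedBall (0 : EuclideanSpace ℝ (Fin d)) 1)) := by
        rw [setLIntegral_const]
        gcongr
        exact volume_annulus_le d n
    _ = _ := by
        have e : -((n : ℝ) * (d * (1 - t / 2))) = (n : ℝ) * (d / 2) * t + -((n : ℝ) * d) := by ring
        rw [e, two_rpow_add, ENNReal.mul_rpow_of_nonneg _ _ ht, ENNReal.mul_rpow_of_nonneg _ _ ht,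
          ← ENNReal.rpow_mul, ← ENNReal.rpow_mul]
        have : -(1 / 2) * t = -(t / 2) := by ring
        rw [this]
        ring

/-- The constant in the bound of `∫ g^t` over the ball of radius `2^{-m}`. -/
noncomputable def ballConst (d : ℕ) (t : ℝ) : ℝ≥0∞ :=
  annulusConst d ^ t * volume (Metric.closedBall (0 : EuclideanSpace ℝ (Fin d)) 1) *
    geomConst (d * (1 - t / 2))

theorem ballConst_ne_top (hd : 0 < d) {t : ℝ} (ht : 0 ≤ t) (ht2 : t < 2) :
    ballConst d t ≠ ∞ :=
  ENNReal.mul_ne_top (ENNReal.mul_ne_top (ENNReal.rpow_ne_top_of_nonneg ht ENNReal.coe_ne_top)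
    measure_closedBall_lt_top.ne)
    (geomConst_ne_top (mul_pos (Nat.cast_pos.2 hd) (by linarith)))

theorem setLIntegral_closedBall_logSingular_le {m : ℕ} (hm : 1 ≤ m) {t : ℝ} (ht : 0 < t) :
    ∫⁻ ξ in Metric.closedBall 0 ((1 / 2) ^ m), ‖logSingular d ξ‖ₑ ^ t ≤
      ballConst d t * ((m : ℝ≥0∞) ^ (-(t / 2)) * 2 ^ (-((m : ℝ) * (d * (1 - t / 2))))) := by
  set e : ℝ := d * (1 - t / 2) with he
  set B : ℝ≥0∞ := annulusConst d ^ t *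
    volume (Metric.closedBall (0 : EuclideanSpace ℝ (Fin d)) 1) with hB
  refine (setLIntegral_closedBall_le_tsum_annulus (by simp [logSingular_zero, ht]) m).trans ?_
  calc ∑' n : ℕ, ∫⁻ ξ in annulus d (m + n), ‖logSingular d ξ‖ₑ ^ t
      ≤ ∑' n : ℕ, B * ((m : ℝ≥0∞) ^ (-(t / 2)) * 2 ^ (-((m : ℝ) * e))) * (2 ^ (-e)) ^ n := by
        refine ENNReal.tsum_le_tsum fun n => ?_
        refine (setLIntegral_annulus_le (by omega) ht.le).trans ?_
        rw [← hB, ← he, mul_assoc B]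
        refine mul_le_mul' le_rfl ?_
        have e1 : -(((m + n : ℕ) : ℝ) * e) = -((m : ℝ) * e) + -e * n := by push_cast; ring
        rw [e1, two_rpow_add, ENNReal.rpow_mul, ENNReal.rpow_natCast, ← mul_assoc]
        gcongr ?_ * _ * _
        rw [ENNReal.rpow_neg, ENNReal.rpow_neg]
        gcongr
        omega
    _ = _ := by
        rw [ENNReal.tsum_mul_left, ENNReal.tsum_geometric, ballConst, ← hB, ← he, geomConst]
        ring

theorem tsum_nat_rpow_neg_ne_top {a : ℝ} (ha : 1 < a) :
    ∑' n : ℕ, ((n + 1 : ℕ) : ℝ≥0∞) ^ (-a) ≠ ∞ := by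
  have h : Summable fun n : ℕ => ((n + 1 : ℕ) : ℝ) ^ (-a) :=
    (summable_nat_add_iff 1 (f := fun n : ℕ => (n : ℝ) ^ (-a))).2
      (Real.summable_nat_rpow.2 (by linarith))
  have h2 := h.tsum_ofReal_ne_top
  have e : ∀ n : ℕ, ENNReal.ofReal (((n + 1 : ℕ) : ℝ) ^ (-a)) = ((n + 1 : ℕ) : ℝ≥0∞) ^ (-a) := by
    intro n
    rw [← ENNReal.ofReal_rpow_of_pos (by positivity), ENNReal.ofReal_natCast]
  simpa only [e] using h2

/-- The function is split at the scale `2^j` along the ball of radius `2^j`. For negative `j` the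
inner part contributes `|j|^{-q/2}`, and the annulus `|ξ| ~ 2^{-n}` contributes `n^{-q/2}` to the
outer part; both are summable because `q > 2`. -/
theorem boxSum_logSingular_near_lt_top (hd : 0 < d) {s q : ℝ} (hs : 1 ≤ s) (hs2 : s < 2)
    (hq : 2 < q) :
    boxSum s q ((Metric.closedBall (0 : EuclideanSpace ℝ (Fin d)) (1 / 2)).indicator
      fun ξ => ‖logSingular d ξ‖ₑ) < ∞ := by
  have hd' : (0 : ℝ) < d := Nat.cast_pos.2 hd
  have hs0 : 0 < s := by linarith
  have hq0 : 0 < q := by linarith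
  set e : ℝ := d * (1 - s / 2) with he
  have he0 : 0 < e := mul_pos hd' (by linarith)
  set b : ℝ := d * (q / 2 - 1) with hb
  have hb0 : 0 < b := mul_pos hd' (by linarith)
  set D : Set (EuclideanSpace ℝ (Fin d)) := Metric.closedBall 0 (1 / 2) with hD
  have hDm : MeasurableSet D := Metric.isClosed_closedBall.measurableSet
  have hgm : Measurable fun ξ => ‖logSingular d ξ‖ₑ := (measurable_logSingular d).enorm
  set u : EuclideanSpace ℝ (Fin d) → ℝ≥0∞ := D.indicator fun ξ => ‖logSingular d ξ‖ₑ with hu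
  have hum : Measurable u := hgm.indicator hDm
  have hup : ∀ {t : ℝ}, 0 < t → ∀ ξ, u ξ ^ t = D.indicator (fun ξ => ‖logSingular d ξ‖ₑ ^ t) ξ := by
    intro t ht ξ
    by_cases h : ξ ∈ D
    · simp [hu, h]
    · simp [hu, h, ht]
  set A : ℤ → Set (EuclideanSpace ℝ (Fin d)) := fun j => Metric.closedBall 0 ((2 : ℝ) ^ j)
  have hA : ∀ j, MeasurableSet (A j) := fun j => Metric.isClosed_closedBall.measurableSet
  refine (boxSum_le_of_split hs0 (by linarith) hum hA).trans_lt
    (ENNReal.mul_lt_top (splitConst_ne_top hs0 (by linarith)).lt_top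
      (ENNReal.add_lt_top.2 ⟨?_, ?_⟩))
  · rw [tsum_of_nat_of_neg_add_one ENNReal.summable ENNReal.summable]
    refine ENNReal.add_lt_top.2 ⟨?_, ?_⟩
    · -- scales at least one: only the integrability of `u ^ s` matters
      set I := ∫⁻ ξ, u ξ ^ s with hI
      have hIt : I ≠ ∞ := by
        have h := setLIntegral_closedBall_logSingular_le (d := d) le_rfl hs0
        have h2 : I = ∫⁻ ξ in Metric.closedBall 0 ((1 / 2) ^ 1), ‖logSingular d ξ‖ₑ ^ s := by
          rw [hI, pow_one, ← hD, ← lintegral_indicator hDm]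
          simp only [hup hs0]
        rw [h2]
        refine ne_top_of_le_ne_top (ENNReal.mul_ne_top (ballConst_ne_top hd hs0.le hs2)
          (ENNReal.mul_ne_top ?_ ?_)) h
        · simp
        · exact two_rpow_ne_top _
      have hc : (2 : ℝ≥0∞) ^ (-(e * (q / s))) < 1 :=
        ENNReal.rpow_lt_one_of_one_lt_of_neg (by norm_num) (by
          have : 0 < e * (q / s) := by positivity
          linarith)
      calc _ ≤ ∑' n : ℕ, I ^ (q / s) * ((2 : ℝ≥0∞) ^ (-(e * (q / s)))) ^ n := by
            refine ENNReal.tsum_le_tsum fun n => ?_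
            rw [ENNReal.mul_rpow_of_nonneg _ _ (by positivity), mul_comm]
            refine mul_le_mul' ?_ (le_of_eq ?_)
            · gcongr
              exact setLIntegral_le_lintegral _ _
            · rw [← ENNReal.rpow_mul, ← ENNReal.rpow_natCast, ← ENNReal.rpow_mul]
              congr 1
              rw [he]
              push_cast
              ring
        _ < ∞ := by
            rw [ENNReal.tsum_mul_left, ENNReal.tsum_geometric]
            refine ENNReal.mul_lt_top (ENNReal.rpow_lt_top_of_nonneg (by positivity) hIt) ?_
            rw [ENNReal.inv_lt_top]
            exact tsub_pos_of_lt hc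
    · -- scales below one
      calc _ ≤ ∑' n : ℕ, ballConst d s ^ (q / s) * ((n + 1 : ℕ) : ℝ≥0∞) ^ (-(q / 2)) := by
            refine ENNReal.tsum_le_tsum fun n => ?_
            have hAD : ∫⁻ ξ in A (-((n : ℤ) + 1)), u ξ ^ s ≤
                ∫⁻ ξ in Metric.closedBall 0 ((1 / 2) ^ (n + 1)), ‖logSingular d ξ‖ₑ ^ s := by
              have : A (-((n : ℤ) + 1)) = Metric.closedBall 0 ((1 / 2) ^ (n + 1)) := by
                simp only [A]
                congr 1
                rw [zpow_neg, one_div, inv_pow]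
                norm_cast
              rw [this]
              refine lintegral_mono fun ξ => ?_
              rw [hup hs0]
              exact Set.indicator_le_self _ _ _
            have h := hAD.trans (setLIntegral_closedBall_logSingular_le (d := d)
              (Nat.le_add_left 1 n) hs0)
            calc _ ≤ (2 ^ ((((-((n : ℤ) + 1) : ℤ)) : ℝ) * (d * (s / 2 - 1))) *
                  (ballConst d s * (((n + 1 : ℕ) : ℝ≥0∞) ^ (-(s / 2)) *
                    2 ^ (-(((n + 1 : ℕ) : ℝ) * (d * (1 - s / 2))))))) ^ (q / s) := by
                  gcongr
              _ = (ballConst d s * ((n + 1 : ℕ) : ℝ≥0∞) ^ (-(s / 2))) ^ (q / s) := by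
                  congr 1
                  have : (2 : ℝ≥0∞) ^ ((((-((n : ℤ) + 1) : ℤ)) : ℝ) * (d * (s / 2 - 1))) *
                      2 ^ (-(((n + 1 : ℕ) : ℝ) * (d * (1 - s / 2)))) = 1 := by
                    rw [← two_rpow_add]
                    convert ENNReal.rpow_zero using 2
                    push_cast
                    ring
                  rw [mul_left_comm, mul_left_comm (2 ^ _ : ℝ≥0∞), this, mul_one]
              _ = _ := by
                  rw [ENNReal.mul_rpow_of_nonneg _ _ (by positivity), ← ENNReal.rpow_mul]
                  congr 2
                  field_simp
        _ < ∞ := by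
            rw [ENNReal.tsum_mul_left]
            exact ENNReal.mul_lt_top (ENNReal.rpow_lt_top_of_nonneg (by positivity)
              (ballConst_ne_top hd hs0.le hs2))
              (tsum_nat_rpow_neg_ne_top (by linarith)).lt_top
  · rw [tsum_mul_setLIntegral_eq (hum.pow_const q) _ fun j => (hA j).compl]
    have hpt : ∀ ξ, u ξ ^ q * ∑' j : ℤ, (A j)ᶜ.indicator
        (fun _ => (2 : ℝ≥0∞) ^ ((j : ℝ) * b)) ξ ≤
        geomConst b * D.indicator (fun ξ => ‖logSingular d ξ‖ₑ ^ q * ‖ξ‖ₑ ^ b) ξ := by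
      intro ξ
      rw [hup hq0]
      by_cases h : ξ ∈ D
      · rw [Set.indicator_of_mem h, Set.indicator_of_mem h, mul_left_comm]
        gcongr
        refine le_trans (ENNReal.tsum_le_tsum fun j => ?_) (tsum_two_rpow_le hb0 ‖ξ‖ₑ)
        by_cases hj : ξ ∈ (A j)ᶜ
        · rw [Set.indicator_of_mem hj, if_pos]
          have : (2 : ℝ) ^ j < ‖ξ‖ := by simpa [A] using hj
          rw [← ofReal_norm]
          refine le_trans (le_of_eq ?_) (ENNReal.ofReal_le_ofReal this.le)
          rw [← Real.rpow_intCast, ← ENNReal.ofReal_rpow_of_pos (by norm_num)]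
          simp
        · rw [Set.indicator_of_notMem hj]
          exact zero_le
      · rw [Set.indicator_of_notMem h, zero_mul]
        exact zero_le
    refine (lintegral_mono hpt).trans_lt ?_
    rw [lintegral_const_mul' _ _ (geomConst_ne_top hb0), lintegral_indicator hDm]
    refine ENNReal.mul_lt_top (geomConst_ne_top hb0).lt_top ?_
    have hD1 : D = Metric.closedBall 0 ((1 / 2) ^ 1) := by rw [hD, pow_one]
    rw [hD1]
    refine (setLIntegral_closedBall_le_tsum_annulus (by simp [logSingular_zero, hq0]) 1).trans_lt ?_
    set B : ℝ≥0∞ := annulusConst d ^ q *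
      volume (Metric.closedBall (0 : EuclideanSpace ℝ (Fin d)) 1) with hB
    have hBt : B ≠ ∞ := ENNReal.mul_ne_top
      (ENNReal.rpow_ne_top_of_nonneg hq0.le ENNReal.coe_ne_top) measure_closedBall_lt_top.ne
    calc _ ≤ ∑' n : ℕ, B * ((n + 1 : ℕ) : ℝ≥0∞) ^ (-(q / 2)) := by
          refine ENNReal.tsum_le_tsum fun n => ?_
          rw [add_comm 1 n]
          calc ∫⁻ ξ in annulus d (n + 1), ‖logSingular d ξ‖ₑ ^ q * ‖ξ‖ₑ ^ b
              ≤ ∫⁻ ξ in annulus d (n + 1), 2 ^ (-(((n + 1 : ℕ) : ℝ) * b)) *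
                ‖logSingular d ξ‖ₑ ^ q := by
                refine setLIntegral_mono ((hgm.pow_const q).const_mul _) fun ξ hξ => ?_
                rw [mul_comm]
                gcongr
                have h1 : ‖ξ‖ₑ ≤ 2 ^ (-((n + 1 : ℕ) : ℝ)) := by
                  rw [← ofReal_norm, ← ofReal_half_pow]
                  exact ENNReal.ofReal_le_ofReal hξ.2
                calc ‖ξ‖ₑ ^ b ≤ (2 ^ (-((n + 1 : ℕ) : ℝ))) ^ b := by gcongr
                  _ = _ := by rw [← ENNReal.rpow_mul, neg_mul]
            _ ≤ 2 ^ (-(((n + 1 : ℕ) : ℝ) * b)) * (B * (((n + 1 : ℕ) : ℝ≥0∞) ^ (-(q / 2)) *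
                  2 ^ (-(((n + 1 : ℕ) : ℝ) * (d * (1 - q / 2)))))) := by
                rw [lintegral_const_mul _ (hgm.pow_const q)]
                gcongr
                exact setLIntegral_annulus_le (Nat.le_add_left 1 n) hq0.le
            _ = _ := by
                have : (2 : ℝ≥0∞) ^ (-(((n + 1 : ℕ) : ℝ) * b)) *
                    2 ^ (-(((n + 1 : ℕ) : ℝ) * (d * (1 - q / 2)))) = 1 := by
                  rw [← two_rpow_add]
                  convert ENNReal.rpow_zero using 2
                  rw [hb]
                  ring
                rw [mul_left_comm, mul_left_comm (2 ^ _ : ℝ≥0∞), this, mul_one]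
      _ < ∞ := by
          rw [ENNReal.tsum_mul_left]
          exact ENNReal.mul_lt_top hBt.lt_top (tsum_nat_rpow_neg_ne_top (by linarith)).lt_top

end LogSingular

/-! ### The model singularity on the unit sphere -/

section Sphere

variable {V : Type*} [NormedAddCommGroup V] [NormedSpace ℝ V] [FiniteDimensional ℝ V]
  [MeasurableSpace V] [BorelSpace V]

theorem lintegral_eq_mul_lintegral_comp_smul (μ : Measure V) [μ.IsAddHaarMeasure]
    {F : V → ℝ≥0∞} (hF : Measurable F) {r : ℝ} (hr : 0 < r) :
    ∫⁻ x, F x ∂μ = ENNReal.ofReal (r ^ Module.finrank ℝ V) * ∫⁻ x, F (r • x) ∂μ := by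
  have h : ∫⁻ x, F (r • x) ∂μ = ∫⁻ x, F x ∂(μ.map (r • ·)) :=
    (lintegral_map hF (measurable_const_smul r)).symm
  rw [h, Measure.map_addHaar_smul μ hr.ne', lintegral_smul_measure, smul_eq_mul, ← mul_assoc,
    ← ENNReal.ofReal_mul (by positivity), abs_of_pos (by positivity),
    mul_inv_cancel₀ (by positivity), ENNReal.ofReal_one, one_mul]

/-- The value of `∫_{[-1, 1]} |y|^{-a} dy`. -/
noncomputable def intervalConst (a : ℝ) : ℝ≥0∞ :=
  ∫⁻ y in Metric.closedBall (0 : ℝ) 1, ENNReal.ofReal |y| ^ (-a)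

theorem intervalConst_ne_top {a : ℝ} (ha : a < 1) : intervalConst a ≠ ∞ := by
  have h : IntegrableOn (fun y : ℝ => |y| ^ (-a)) (Metric.ball 0 2) :=
    integrableOn_ball_of_norm_le_rpow (C := 1) (α := a) (by simp) (by simpa using ha)
      (Filter.Eventually.of_forall fun x => by
        rw [one_mul, Real.norm_eq_abs, Real.norm_eq_abs, abs_of_nonneg (by positivity)])
      (measurable_norm.pow_const _).aestronglyMeasurable
  have h1 := h.lintegral_lt_top
  refine ((lintegral_mono_ae ?_).trans_lt ((lintegral_mono_set (Metric.closedBall_subset_ball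
    (by norm_num : (1 : ℝ) < 2))).trans_lt h1)).ne
  have h0 : ∀ᵐ y : ℝ, y ≠ 0 := by simp [ae_iff, measure_singleton]
  filter_upwards [ae_restrict_of_ae h0] with y hy
  rw [ENNReal.ofReal_rpow_of_pos (abs_pos.2 hy)]

theorem lintegral_closedBall_abs_rpow {a h : ℝ} (hh : 0 < h) :
    ∫⁻ y in Metric.closedBall (0 : ℝ) h, ENNReal.ofReal |y| ^ (-a) =
      ENNReal.ofReal h ^ (1 - a) * intervalConst a := by
  have hm : Measurable fun y : ℝ => ENNReal.ofReal |y| ^ (-a) := by fun_prop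
  have hb : ∀ r : ℝ, MeasurableSet (Metric.closedBall (0 : ℝ) r) := fun r =>
    Metric.isClosed_closedBall.measurableSet
  have h0 : ENNReal.ofReal h ≠ 0 := by simpa using hh
  have hc : ENNReal.ofReal h ^ (-a) ≠ ∞ := by
    simp [ENNReal.rpow_eq_top_iff, h0]
  rw [← lintegral_indicator (hb h), lintegral_eq_mul_lintegral_comp_smul _
    (hm.indicator (hb h)) hh, intervalConst, ← lintegral_indicator (hb 1)]
  have : ∀ y : ℝ,
      (Metric.closedBall (0 : ℝ) h).indicator (fun y => ENNReal.ofReal |y| ^ (-a)) (h • y) =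
        ENNReal.ofReal h ^ (-a) *
        (Metric.closedBall (0 : ℝ) 1).indicator (fun y => ENNReal.ofReal |y| ^ (-a)) y := by
    intro y
    have hiff : h • y ∈ Metric.closedBall (0 : ℝ) h ↔ y ∈ Metric.closedBall (0 : ℝ) 1 := by
      rw [mem_closedBall_zero_iff, mem_closedBall_zero_iff, norm_smul, Real.norm_eq_abs,
        abs_of_pos hh]
      exact mul_le_iff_le_one_right hh
    by_cases hy : y ∈ Metric.closedBall (0 : ℝ) 1
    · rw [Set.indicator_of_mem (hiff.2 hy), Set.indicator_of_mem hy, smul_eq_mul, abs_mul,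
        abs_of_pos hh, ENNReal.ofReal_mul hh.le,
        ENNReal.mul_rpow_of_ne_top ENNReal.ofReal_ne_top ENNReal.ofReal_ne_top]
    · rw [Set.indicator_of_notMem (fun h' => hy (hiff.1 h')), Set.indicator_of_notMem hy, mul_zero]
  simp only [this]
  rw [lintegral_const_mul' _ _ hc, ← mul_assoc]
  congr 1
  rw [sub_eq_add_neg, ENNReal.rpow_add _ _ h0 ENNReal.ofReal_ne_top, ENNReal.rpow_one]
  simp

/-- The bound is uniform in the position of the singularity `t`. -/
theorem lintegral_Icc_abs_sub_rpow_le {a : ℝ} (ha : 0 ≤ a) {h : ℝ} (hh : 0 < h) (x t : ℝ) :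
    ∫⁻ y in Set.Icc x (x + h), ENNReal.ofReal |y - t| ^ (-a) ≤
      (intervalConst a + 1) * ENNReal.ofReal h ^ (1 - a) := by
  have h0 : ENNReal.ofReal h ≠ 0 := by simpa using hh
  have hm : Measurable fun y : ℝ => ENNReal.ofReal |y| ^ (-a) := by fun_prop
  have hmt : Measurable fun y : ℝ => ENNReal.ofReal |y - t| ^ (-a) := by fun_prop
  have hb : MeasurableSet (Metric.closedBall (0 : ℝ) h) := Metric.isClosed_closedBall.measurableSet
  -- either `|y - t| ≤ h`, or the integrand is at most `h ^ (-a)`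
  have hpt : ∀ y, (Set.Icc x (x + h)).indicator (fun y => ENNReal.ofReal |y - t| ^ (-a)) y ≤
      (Metric.closedBall (0 : ℝ) h).indicator (fun y => ENNReal.ofReal |y| ^ (-a)) (y - t) +
        (Set.Icc x (x + h)).indicator (fun _ => ENNReal.ofReal h ^ (-a)) y := by
    intro y
    by_cases hy : y ∈ Set.Icc x (x + h)
    swap
    · rw [Set.indicator_of_notMem hy]; exact zero_le
    rw [Set.indicator_of_mem hy, Set.indicator_of_mem hy]
    by_cases hyt : y - t ∈ Metric.closedBall (0 : ℝ) h
    · rw [Set.indicator_of_mem hyt]; exact le_self_add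
    · have : h ≤ |y - t| := by
        rw [mem_closedBall_zero_iff, Real.norm_eq_abs, not_le] at hyt
        exact hyt.le
      refine le_add_of_nonneg_of_le zero_le ?_
      rw [ENNReal.rpow_neg, ENNReal.rpow_neg]
      gcongr
  rw [← lintegral_indicator measurableSet_Icc]
  refine (lintegral_mono hpt).trans ?_
  rw [lintegral_add_right _ (measurable_const.indicator measurableSet_Icc),
    lintegral_sub_right_eq_self (μ := volume)
      (fun y => (Metric.closedBall (0 : ℝ) h).indicator (fun y => ENNReal.ofReal |y| ^ (-a)) y) t,
    lintegral_indicator hb, lintegral_closedBall_abs_rpow hh, lintegral_indicator measurableSet_Icc,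
    setLIntegral_const, Real.volume_Icc, add_sub_cancel_left, add_mul, one_mul, mul_comm]
  gcongr
  rw [sub_eq_add_neg, add_comm (1 : ℝ), ENNReal.rpow_add _ _ h0 ENNReal.ofReal_ne_top,
    ENNReal.rpow_one]

/-- The model singularity `|1 - |ξ||^{-a}` on the shell `1/2 ≤ |ξ| ≤ R`; with values in `ℝ≥0∞` it is
`∞` on the unit sphere if `a > 0`. -/
noncomputable def sphereWeight (V : Type*) [NormedAddCommGroup V] (R a : ℝ) : V → ℝ≥0∞ :=
  Set.indicator {ξ | 1 / 2 ≤ ‖ξ‖ ∧ ‖ξ‖ ≤ R} fun ξ => ENNReal.ofReal |1 - ‖ξ‖| ^ (-a)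

theorem measurableSet_shell {V : Type*} [NormedAddCommGroup V] [MeasurableSpace V]
    [OpensMeasurableSpace V] (R : ℝ) : MeasurableSet {ξ : V | 1 / 2 ≤ ‖ξ‖ ∧ ‖ξ‖ ≤ R} :=
  (measurableSet_le measurable_const measurable_norm).inter
    (measurableSet_le measurable_norm measurable_const)

theorem measurable_sphereWeight {V : Type*} [NormedAddCommGroup V] [MeasurableSpace V]
    [OpensMeasurableSpace V] (R a : ℝ) : Measurable (sphereWeight V R a) :=
  Measurable.indicator (by fun_prop) (measurableSet_shell R)

/-- The constant in the bound of the integral of `sphereWeight` over a ball. -/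
noncomputable def sphereConst (μ : Measure V) (R a : ℝ) : ℝ≥0∞ :=
  ENNReal.ofReal ((1 + R) ^ Module.finrank ℝ V) *
    (ENNReal.ofReal (1 / (2 * (1 + R))) ^ (-a) * (intervalConst a + 1) *
      (ENNReal.ofReal ((1 + R) ^ Module.finrank ℝ V) * μ (Metric.closedBall 0 1)))

theorem sphereConst_ne_top (μ : Measure V) [IsLocallyFiniteMeasure μ] {R a : ℝ} (hR : 0 < R)
    (ha1 : a < 1) : sphereConst μ R a ≠ ∞ := by
  have h0 : 0 < 1 / (2 * (1 + R)) := by positivity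
  refine ENNReal.mul_ne_top ENNReal.ofReal_ne_top (ENNReal.mul_ne_top (ENNReal.mul_ne_top ?_ ?_)
    (ENNReal.mul_ne_top ENNReal.ofReal_ne_top measure_closedBall_lt_top.ne))
  · rw [ENNReal.ofReal_rpow_of_pos h0]
    exact ENNReal.ofReal_ne_top
  · simp [intervalConst_ne_top ha1]

/-- Polar coordinates are avoided by averaging over dilations: the integral over a ball of radius
`h` is compared with the one over its dilates by `l ∈ [1, 1 + h]`, and for each point of a slightly
larger ball the average over `l` of `|1 - l |η||^{-a}` is `O(h^{-a})`. -/
theorem setLIntegral_sphereWeight_le (μ : Measure V) [μ.IsAddHaarMeasure] {R a : ℝ} (hR : 0 < R)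
    (ha : 0 ≤ a) (c : V) {h : ℝ} (hh : 0 < h) (hhR : h ≤ R) :
    ∫⁻ ξ in Metric.closedBall c h, sphereWeight V R a ξ ∂μ ≤
      sphereConst μ R a * ENNReal.ofReal h ^ ((Module.finrank ℝ V : ℝ) - a) := by
  set D := Module.finrank ℝ V with hD
  set ρ : ℝ := 1 / (2 * (1 + R)) with hρ
  have hρ0 : 0 < ρ := by positivity
  have h0 : ENNReal.ofReal h ≠ 0 := by simpa using hh
  set w := sphereWeight V R a
  have hw : Measurable w := measurable_sphereWeight R a
  set B := Metric.closedBall c h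
  set B' := Metric.closedBall c ((1 + R) * h)
  have hB : MeasurableSet B := Metric.isClosed_closedBall.measurableSet
  have hB' : MeasurableSet B' := Metric.isClosed_closedBall.measurableSet
  set E : Set V := B' ∩ {η | ρ ≤ ‖η‖}
  have hE : MeasurableSet E := hB'.inter (measurableSet_le measurable_const measurable_norm)
  set I := ∫⁻ ξ in B, w ξ ∂μ with hI
  have hG : Measurable fun p : ℝ × V => ENNReal.ofReal |1 - p.1 * ‖p.2‖| ^ (-a) := by fun_prop
  -- the substitution `ξ = l • η`
  have hl : ∀ l ∈ Set.Icc (1 : ℝ) (1 + h), I ≤ ENNReal.ofReal ((1 + R) ^ D) *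
      ∫⁻ η in E, ENNReal.ofReal |1 - l * ‖η‖| ^ (-a) ∂μ := by
    intro l hl
    have hl0 : 0 < l := by linarith [hl.1]
    have hlR : l ≤ 1 + R := hl.2.trans (by linarith)
    rw [hI, ← lintegral_indicator hB, lintegral_eq_mul_lintegral_comp_smul μ (hw.indicator hB) hl0,
      ← lintegral_indicator hE]
    refine mul_le_mul' (ENNReal.ofReal_le_ofReal (by gcongr)) (lintegral_mono fun η => ?_)
    by_cases h1 : l • η ∈ B
    swap
    · rw [Set.indicator_of_notMem h1]; exact zero_le
    by_cases h2 : l • η ∈ {ξ : V | 1 / 2 ≤ ‖ξ‖ ∧ ‖ξ‖ ≤ R}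
    swap
    · rw [Set.indicator_of_mem h1]
      simp only [w, sphereWeight]
      rw [Set.indicator_of_notMem h2]; exact zero_le
    have hnorm : ‖l • η‖ = l * ‖η‖ := by rw [norm_smul, Real.norm_eq_abs, abs_of_pos hl0]
    have h3 : 1 / 2 ≤ l * ‖η‖ ∧ l * ‖η‖ ≤ R := by rw [← hnorm]; exact h2
    have hηE : η ∈ E := by
      constructor
      · have h4 : dist η (l • η) ≤ R * h := by
          have : η - l • η = (1 - l) • η := by rw [sub_smul, one_smul]
          rw [dist_eq_norm, this, norm_smul, Real.norm_eq_abs, abs_of_nonpos (by linarith [hl.1])]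
          have h5 : ‖η‖ ≤ R := le_trans (by nlinarith [norm_nonneg η, hl.1]) h3.2
          nlinarith [norm_nonneg η, hl.1, hl.2]
        rw [Metric.mem_closedBall]
        have := dist_triangle η (l • η) c
        have h6 : dist (l • η) c ≤ h := h1
        linarith
      · change ρ ≤ ‖η‖
        rw [hρ, div_le_iff₀ (by positivity)]
        nlinarith [norm_nonneg η, h3.1]
    rw [Set.indicator_of_mem h1, Set.indicator_of_mem hηE]
    simp only [w, sphereWeight]
    rw [Set.indicator_of_mem h2, hnorm]
  -- average over `l`
  have hinner : ∀ η ∈ E, ∫⁻ l in Set.Icc (1 : ℝ) (1 + h), ENNReal.ofReal |1 - l * ‖η‖| ^ (-a) ≤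
      ENNReal.ofReal ρ ^ (-a) * ((intervalConst a + 1) * ENNReal.ofReal h ^ (1 - a)) := by
    intro η hη
    have hηρ : ρ ≤ ‖η‖ := hη.2
    have hη0 : 0 < ‖η‖ := hρ0.trans_le hηρ
    have hρt : ENNReal.ofReal ρ ^ (-a) ≠ ∞ := by
      rw [ENNReal.ofReal_rpow_of_pos hρ0]; exact ENNReal.ofReal_ne_top
    calc _ ≤ ∫⁻ l in Set.Icc (1 : ℝ) (1 + h), ENNReal.ofReal ρ ^ (-a) *
          ENNReal.ofReal |l - ‖η‖⁻¹| ^ (-a) := by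
          refine lintegral_mono fun l => ?_
          rw [← ENNReal.mul_rpow_of_ne_top ENNReal.ofReal_ne_top ENNReal.ofReal_ne_top,
            ← ENNReal.ofReal_mul hρ0.le, ENNReal.rpow_neg, ENNReal.rpow_neg]
          gcongr
          calc ρ * |l - ‖η‖⁻¹| ≤ ‖η‖ * |l - ‖η‖⁻¹| := by gcongr
            _ = |1 - l * ‖η‖| := by
                rw [← abs_of_pos hη0, ← abs_mul, abs_of_pos hη0, abs_sub_comm]
                congr 1
                field_simp
      _ ≤ _ := by
          rw [lintegral_const_mul' _ _ hρt]
          gcongr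
          exact lintegral_Icc_abs_sub_rpow_le ha hh 1 _
  have hEvol : μ E ≤ ENNReal.ofReal ((1 + R) ^ D) * ENNReal.ofReal h ^ (D : ℝ) *
      μ (Metric.closedBall 0 1) := by
    refine (measure_mono Set.inter_subset_left).trans_eq ?_
    rw [Measure.addHaar_closedBall' _ _ (by positivity), mul_pow,
      ENNReal.ofReal_mul (by positivity),
      ENNReal.ofReal_pow hh.le, ENNReal.rpow_natCast]
  have havg : ENNReal.ofReal h * I ≤ ENNReal.ofReal ((1 + R) ^ D) *
      (ENNReal.ofReal ρ ^ (-a) * ((intervalConst a + 1) * ENNReal.ofReal h ^ (1 - a)) * μ E) := by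
    calc ENNReal.ofReal h * I = ∫⁻ _l in Set.Icc (1 : ℝ) (1 + h), I := by
          rw [setLIntegral_const, Real.volume_Icc, add_sub_cancel_left, mul_comm]
      _ ≤ ∫⁻ l in Set.Icc (1 : ℝ) (1 + h), ENNReal.ofReal ((1 + R) ^ D) *
            ∫⁻ η in E, ENNReal.ofReal |1 - l * ‖η‖| ^ (-a) ∂μ :=
          setLIntegral_mono' measurableSet_Icc hl
      _ = ENNReal.ofReal ((1 + R) ^ D) * ∫⁻ η in E, (∫⁻ l in Set.Icc (1 : ℝ) (1 + h),
            ENNReal.ofReal |1 - l * ‖η‖| ^ (-a)) ∂μ := by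
          rw [lintegral_const_mul' _ _ ENNReal.ofReal_ne_top]
          congr 1
          exact lintegral_lintegral_swap
            (f := fun (l : ℝ) (η : V) => ENNReal.ofReal |1 - l * ‖η‖| ^ (-a)) hG.aemeasurable
      _ ≤ ENNReal.ofReal ((1 + R) ^ D) * ∫⁻ _η in E, ENNReal.ofReal ρ ^ (-a) *
            ((intervalConst a + 1) * ENNReal.ofReal h ^ (1 - a)) ∂μ := by
          exact mul_le_mul' le_rfl (setLIntegral_mono' hE hinner)
      _ = _ := by rw [setLIntegral_const]
  rw [← ENNReal.mul_le_mul_iff_right h0 ENNReal.ofReal_ne_top]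
  refine havg.trans ((mul_le_mul' le_rfl (mul_le_mul' le_rfl hEvol)).trans_eq ?_)
  have e : ENNReal.ofReal h * ENNReal.ofReal h ^ ((D : ℝ) - a) =
      ENNReal.ofReal h ^ (1 - a) * ENNReal.ofReal h ^ (D : ℝ) := by
    nth_rw 1 [← ENNReal.rpow_one (ENNReal.ofReal h)]
    rw [← ENNReal.rpow_add _ _ h0 ENNReal.ofReal_ne_top,
      ← ENNReal.rpow_add _ _ h0 ENNReal.ofReal_ne_top]
    ring_nf
  rw [mul_left_comm (ENNReal.ofReal h), e, sphereConst]
  ring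

end Sphere

section LogSingular

variable {d : ℕ}

/-! ### The norm of `g` -/

theorem boxSum_mono {s q : ℝ} (hs : 0 < s) (hq : 0 < q)
    {u v : EuclideanSpace ℝ (Fin d) → ℝ≥0∞} (h : ∀ ξ, u ξ ≤ v ξ) : boxSum s q u ≤ boxSum s q v := by
  unfold boxSum
  gcongr with j k ξ
  exact h ξ

/-- `boxSum` is increasing in the exponent `s` up to a constant, by Hölder's inequality on each
cube; the weights are such that no power of the scale is lost. -/
theorem boxSum_le_of_le_exponent {s t q : ℝ} (hs : 0 < s) (hst : s ≤ t) (hq : 0 < q)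
    {u : EuclideanSpace ℝ (Fin d) → ℝ≥0∞} (hu : Measurable u) :
    boxSum s q u ≤ boxVolume d ^ ((t / s - 1) * (q / t)) * boxSum t q u := by
  have ht : 0 < t := hs.trans_le hst
  have hr : 1 ≤ t / s := by rwa [le_div_iff₀ hs, one_mul]
  rw [boxSum, boxSum, ← ENNReal.tsum_mul_left]
  refine ENNReal.tsum_le_tsum fun j => ?_
  rw [mul_left_comm, ← ENNReal.tsum_mul_left, ← ENNReal.tsum_mul_left, ← ENNReal.tsum_mul_left]
  refine ENNReal.tsum_le_tsum fun k => ?_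
  have h1 := lintegral_rpow_le (volume.restrict (dyadicBox j k)) hr (hu.pow_const s).aemeasurable
  simp only [← ENNReal.rpow_mul, mul_div_cancel₀ _ hs.ne', Measure.restrict_apply_univ,
    volume_dyadicBox] at h1
  have h2 := ENNReal.rpow_le_rpow h1 (div_pos hq ht).le
  have e1 : t / s * (q / t) = q / s := by field_simp
  rw [← ENNReal.rpow_mul, e1, ENNReal.mul_rpow_of_nonneg _ _ (by positivity), ← ENNReal.rpow_mul,
    ENNReal.mul_rpow_of_nonneg _ _ (mul_nonneg (by linarith) (by positivity)),
    ← ENNReal.rpow_mul] at h2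
  have e2 : (j : ℝ) * d * ((t - 2) / (2 * t)) * q = (j : ℝ) * d * ((s - 2) / (2 * s)) * q +
      (j : ℝ) * d * ((t / s - 1) * (q / t)) := by field_simp; ring
  refine (mul_le_mul' le_rfl h2).trans_eq ?_
  rw [e2, two_rpow_add]
  ring

theorem boxSum_le_indicator_add {s q : ℝ} (hs : 0 < s) (hsq : s ≤ q)
    {u : EuclideanSpace ℝ (Fin d) → ℝ≥0∞} (hu : Measurable u)
    {A : Set (EuclideanSpace ℝ (Fin d))} (hA : MeasurableSet A) :
    boxSum s q u ≤
      2 ^ (q / s - 1) * (boxSum s q (A.indicator u) + boxSum s q (Aᶜ.indicator u)) := by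
  have hr : 1 ≤ q / s := by rwa [le_div_iff₀ hs, one_mul]
  rw [boxSum, boxSum, boxSum, ← ENNReal.tsum_add, ← ENNReal.tsum_mul_left]
  refine ENNReal.tsum_le_tsum fun j => ?_
  rw [← mul_add, mul_left_comm, ← ENNReal.tsum_add, ← ENNReal.tsum_mul_left (a := 2 ^ (q / s - 1))]
  refine mul_le_mul' le_rfl (ENNReal.tsum_le_tsum fun k => ?_)
  have : ∫⁻ ξ in dyadicBox j k, u ξ ^ s = (∫⁻ ξ in dyadicBox j k, A.indicator u ξ ^ s) +
      ∫⁻ ξ in dyadicBox j k, Aᶜ.indicator u ξ ^ s := by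
    rw [← lintegral_add_left ((hu.indicator hA).pow_const s)]
    congr 1 with ξ
    by_cases h : ξ ∈ A
    · simp [h, hs]
    · simp [h, hs]
  rw [this]
  exact ENNReal.rpow_add_le_mul_rpow_add_rpow _ _ hr

theorem sphereWeight_rpow (R a : ℝ) {t : ℝ} (ht : 0 < t) (ξ : EuclideanSpace ℝ (Fin d)) :
    sphereWeight (EuclideanSpace ℝ (Fin d)) R a ξ ^ t =
      sphereWeight (EuclideanSpace ℝ (Fin d)) R (a * t) ξ := by
  simp only [sphereWeight, Set.indicator_apply]
  split_ifs
  · rw [← ENNReal.rpow_mul, neg_mul]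
  · exact ENNReal.zero_rpow_of_pos ht

theorem lintegral_sphereWeight_ne_top (hd : 0 < d) {a : ℝ} (ha : 0 ≤ a) (ha1 : a < 1) :
    ∫⁻ ξ, sphereWeight (EuclideanSpace ℝ (Fin d)) d a ξ ≠ ∞ := by
  have hd' : (0 : ℝ) < d := Nat.cast_pos.2 hd
  have h := setLIntegral_sphereWeight_le (volume : Measure (EuclideanSpace ℝ (Fin d))) hd' ha 0 hd'
    le_rfl
  have h1 : ∫⁻ ξ, sphereWeight (EuclideanSpace ℝ (Fin d)) d a ξ =
      ∫⁻ ξ in Metric.closedBall 0 (d : ℝ), sphereWeight (EuclideanSpace ℝ (Fin d)) d a ξ := by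
    rw [setLIntegral_eq_of_support_subset]
    intro ξ hξ
    have := Set.mem_of_indicator_ne_zero hξ
    simpa using this.2
  rw [h1]
  refine ne_top_of_le_ne_top (ENNReal.mul_ne_top (sphereConst_ne_top _ hd' ha1) ?_) h
  rw [ENNReal.ofReal_rpow_of_pos hd']
  exact ENNReal.ofReal_ne_top

/-- On a cube of side `2^j ≤ 1` the integral of the weight is `O(2^{j(d - s/2)})`, while the sum
over the cubes of one scale is bounded. The resulting series over the scales is geometric, and `hκ`
says that it converges. -/
theorem boxSum_sphereWeight_lt_top_of_pos {s q : ℝ} (hs : 1 ≤ s) (hs2 : s < 2)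
    (hq : 2 < q) (hd : 0 < d) (hκ : 0 < (d - 1) * (q - 2) + s - 2) :
    boxSum s q (sphereWeight (EuclideanSpace ℝ (Fin d)) d (1 / 2)) < ∞ := by
  have hd' : (0 : ℝ) < d := Nat.cast_pos.2 hd
  have hd1 : (1 : ℝ) ≤ d := by exact_mod_cast hd
  have hs0 : 0 < s := by linarith
  have hr : 1 ≤ q / s := by rw [le_div_iff₀ hs0]; linarith
  set a : ℝ := 1 / 2 * s with ha
  have ha0 : 0 ≤ a := by positivity
  have ha1 : a < 1 := by linarith
  set w := sphereWeight (EuclideanSpace ℝ (Fin d)) d a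
  have hw : Measurable w := measurable_sphereWeight _ _
  set J := ∫⁻ ξ, w ξ
  have hJ : J ≠ ∞ := lintegral_sphereWeight_ne_top hd ha0 ha1
  have h3 : (3 : ℝ≥0∞) ^ d ≠ ∞ := ENNReal.pow_ne_top (by norm_num)
  simp only [boxSum, sphereWeight_rpow _ _ hs0]
  rw [tsum_of_nat_of_neg_add_one ENNReal.summable ENNReal.summable]
  refine ENNReal.add_lt_top.2 ⟨?_, ?_⟩
  · -- large scales: only the integrability of `w` matters
    set e : ℝ := d * ((2 - s) / (2 * s)) * q with he
    have he0 : 0 < e := by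
      have : 0 < 2 - s := by linarith
      positivity
    calc _ ≤ ∑' n : ℕ, (3 ^ d * J) ^ (q / s) * ((2 : ℝ≥0∞) ^ (-e)) ^ n := by
          refine ENNReal.tsum_le_tsum fun n => ?_
          rw [mul_comm]
          refine mul_le_mul' ((tsum_rpow_le_rpow_tsum hr _).trans
            (ENNReal.rpow_le_rpow (tsum_lintegral_dyadicBox_le _ hw) (by linarith))) (le_of_eq ?_)
          rw [← ENNReal.rpow_natCast, ← ENNReal.rpow_mul]
          congr 1
          rw [he]
          push_cast
          field_simp
          ring
      _ < ∞ := by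
          rw [ENNReal.tsum_mul_left, ENNReal.tsum_geometric]
          exact ENNReal.mul_lt_top (ENNReal.rpow_lt_top_of_nonneg (by positivity)
            (ENNReal.mul_ne_top h3 hJ)) (geomConst_ne_top he0).lt_top
  · -- small scales: on each box the integral is `O(2^{j(d - s/2)})`
    set κ : ℝ := d * ((s - 2) / (2 * s)) * q + (d - a) * (q / s - 1) with hκdef
    have hκ0 : 0 < κ := by
      have : κ = ((d - 1) * (q - 2) + s - 2) / 2 := by
        rw [hκdef, ha]; field_simp; ring
      rw [this]; linarith
    set M := sphereConst (volume : Measure (EuclideanSpace ℝ (Fin d))) d a *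
      ENNReal.ofReal d ^ ((d : ℝ) - a) with hM
    have hMt : M ≠ ∞ := by
      refine ENNReal.mul_ne_top (sphereConst_ne_top _ hd' ha1) ?_
      rw [ENNReal.ofReal_rpow_of_pos hd']
      exact ENNReal.ofReal_ne_top
    set K := M ^ (q / s - 1) * (3 ^ d * J) with hK
    have hKt : K ≠ ∞ := ENNReal.mul_ne_top (ENNReal.rpow_ne_top_of_nonneg (by linarith) hMt)
      (ENNReal.mul_ne_top h3 hJ)
    have hpow : ∀ x : ℝ≥0∞, x ^ (q / s) = x ^ (q / s - 1) * x := fun x => by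
      nth_rw 3 [← ENNReal.rpow_one x]
      rw [← ENNReal.rpow_add_of_nonneg _ _ (by linarith) zero_le_one]
      ring_nf
    calc _ ≤ ∑' n : ℕ, K * 2 ^ (-κ) * ((2 : ℝ≥0∞) ^ (-κ)) ^ n := by
          refine ENNReal.tsum_le_tsum fun n => ?_
          set N : ℝ := ((n + 1 : ℕ) : ℝ) with hN
          have hbox : ∀ k : Fin d → ℤ, ∫⁻ ξ in dyadicBox (-((n : ℤ) + 1)) k, w ξ ≤
              M * 2 ^ (-(N * (d - a))) := by
            intro k
            have hz : (2 : ℝ) ^ (-((n : ℤ) + 1)) = (1 / 2) ^ (n + 1) := by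
              rw [zpow_neg, one_div, inv_pow]
              norm_cast
            have hle : (1 / 2 : ℝ) ^ (n + 1) ≤ 1 := pow_le_one₀ (by norm_num) (by norm_num)
            have h := (lintegral_mono_set (f := w) (μ := volume)
              (dyadicBox_subset_closedBall (-((n : ℤ) + 1)) k)).trans
              (setLIntegral_sphereWeight_le (volume : Measure (EuclideanSpace ℝ (Fin d))) hd' ha0 _
                (by positivity) (by rw [hz]; nlinarith))
            refine h.trans_eq ?_
            rw [finrank_euclideanSpace_fin, hz, ENNReal.ofReal_mul hd'.le, ofReal_half_pow,
              ENNReal.mul_rpow_of_ne_top ENNReal.ofReal_ne_top (two_rpow_ne_top _),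
              ← ENNReal.rpow_mul, ← mul_assoc, ← hM, neg_mul]
          have hsum : ∑' k : Fin d → ℤ,
              (∫⁻ ξ in dyadicBox (-((n : ℤ) + 1)) k, w ξ) ^ (q / s) ≤
              (M * 2 ^ (-(N * (d - a)))) ^ (q / s - 1) * (3 ^ d * J) := by
            calc _ ≤ ∑' k : Fin d → ℤ, (M * 2 ^ (-(N * (d - a)))) ^ (q / s - 1) *
                  ∫⁻ ξ in dyadicBox (-((n : ℤ) + 1)) k, w ξ := by
                  refine ENNReal.tsum_le_tsum fun k => ?_
                  rw [hpow]
                  exact mul_le_mul' (ENNReal.rpow_le_rpow (hbox k) (by linarith)) le_rfl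
              _ ≤ _ := by
                  rw [ENNReal.tsum_mul_left]
                  exact mul_le_mul' le_rfl (tsum_lintegral_dyadicBox_le _ hw)
          refine (mul_le_mul' le_rfl hsum).trans_eq ?_
          rw [ENNReal.mul_rpow_of_nonneg _ _ (by linarith),
            ← ENNReal.rpow_natCast (2 ^ (-κ)) n, ← ENNReal.rpow_mul, ← ENNReal.rpow_mul, hK]
          have e1 : (2 : ℝ≥0∞) ^ (-κ) * 2 ^ (-κ * (n : ℝ)) =
              2 ^ (((-((n : ℤ) + 1) : ℤ) : ℝ) * d * ((s - 2) / (2 * s)) * q) *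
                2 ^ (-(N * (d - a)) * (q / s - 1)) := by
            rw [← two_rpow_add, ← two_rpow_add]
            congr 1
            rw [hκdef, hN]
            push_cast
            ring
          rw [mul_assoc _ (2 ^ (-κ)), e1]
          ring
      _ < ∞ := by
          rw [ENNReal.tsum_mul_left, ENNReal.tsum_geometric]
          exact ENNReal.mul_lt_top (ENNReal.mul_lt_top hKt.lt_top (two_rpow_ne_top _).lt_top)
            (geomConst_ne_top hκ0).lt_top

theorem boxSum_sphereWeight_lt_top {s q : ℝ} (hs : 1 ≤ s) (hs2 : s < 2) (hq : 2 < q)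
    (hd : 2 ≤ d) : boxSum s q (sphereWeight (EuclideanSpace ℝ (Fin d)) d (1 / 2)) < ∞ := by
  -- raising the exponent `s` to one close to `2` makes the series over the scales converge
  set t : ℝ := max s (2 - (q - 2) / 2) with ht
  have hst : s ≤ t := le_max_left _ _
  have ht2 : t < 2 := max_lt hs2 (by linarith)
  have htq : 2 - (q - 2) / 2 ≤ t := le_max_right _ _
  have hd1 : (2 : ℝ) ≤ d := by exact_mod_cast hd
  refine (boxSum_le_of_le_exponent (by linarith) hst (by linarith)
    (measurable_sphereWeight _ _)).trans_lt (ENNReal.mul_lt_top ?_ ?_)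
  · refine ENNReal.rpow_lt_top_of_nonneg (mul_nonneg ?_ (by positivity)) (boxVolume_ne_top d)
    rw [sub_nonneg, le_div_iff₀ (by linarith)]
    linarith
  · exact boxSum_sphereWeight_lt_top_of_pos (by linarith) ht2 hq (by omega) (by nlinarith)

theorem norm_le_of_mem_openCube {ξ : EuclideanSpace ℝ (Fin d)}
    (hξ : ∀ i, ξ i ∈ Set.Ioo (0 : ℝ) (1 / 2)) : ‖ξ‖ ≤ d / 2 := by
  rw [EuclideanSpace.norm_eq]
  apply Real.sqrt_le_iff.2 ⟨by positivity, ?_⟩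
  have h : ∀ i ∈ Finset.univ, ‖ξ i‖ ^ 2 ≤ (1 / 2 : ℝ) ^ 2 := by
    intro i _
    rw [Real.norm_eq_abs, abs_of_pos (hξ i).1]
    gcongr
    · exact (hξ i).1.le
    · exact (hξ i).2.le
  refine (Finset.sum_le_sum h).trans ?_
  rw [Finset.sum_const, Finset.card_univ, Fintype.card_fin, nsmul_eq_mul, div_pow]
  have : (d : ℝ) ≤ (d : ℝ) ^ 2 := by exact_mod_cast Nat.le_self_pow (by norm_num) d
  linarith

theorem abs_one_sub_div_le_abs_log {r R : ℝ} (hr : 0 < r) (hrR : r ≤ R) (hR : 1 ≤ R) :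
    |1 - r| / R ≤ |Real.log r| := by
  rw [div_le_iff₀ (by linarith)]
  rcases le_total r 1 with h | h
  · have h1 := Real.log_le_sub_one_of_pos hr
    rw [abs_of_nonneg (by linarith), abs_of_nonpos (by linarith)]
    nlinarith
  · have h1 := Real.one_sub_inv_le_log_of_pos hr
    have h2 : 0 ≤ Real.log r := Real.log_nonneg h
    rw [abs_of_nonpos (by linarith), abs_of_nonneg h2]
    have h3 : r - 1 ≤ Real.log r * r := by
      have := mul_le_mul_of_nonneg_right h1 hr.le
      rwa [sub_mul, inv_mul_cancel₀ hr.ne', one_mul] at this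
    nlinarith

theorem logSingular_of_notMem {ξ : EuclideanSpace ℝ (Fin d)}
    (hξ : ¬ ∀ i, ξ i ∈ Set.Ioo (0 : ℝ) (1 / 2)) : logSingular d ξ = 0 :=
  Set.indicator_of_notMem
    (s := {ξ : EuclideanSpace ℝ (Fin d) | ∀ i, ξ i ∈ Set.Ioo (0 : ℝ) (1 / 2)}) hξ _

/-- Away from the origin `g` is dominated by the singularity on the unit sphere. -/
theorem indicator_compl_logSingular_le (hd : 0 < d) (ξ : EuclideanSpace ℝ (Fin d)) :
    (Metric.closedBall (0 : EuclideanSpace ℝ (Fin d)) (1 / 2))ᶜ.indicator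
      (fun ξ => ‖logSingular d ξ‖ₑ) ξ ≤
    ENNReal.ofReal ((2 : ℝ) ^ ((d : ℝ) / 2) * (d : ℝ) ^ (1 / 2 : ℝ)) *
      sphereWeight (EuclideanSpace ℝ (Fin d)) d (1 / 2) ξ := by
  have hd' : (0 : ℝ) < d := Nat.cast_pos.2 hd
  have hd1 : (1 : ℝ) ≤ d := by exact_mod_cast hd
  by_cases hξ : ξ ∈ (Metric.closedBall (0 : EuclideanSpace ℝ (Fin d)) (1 / 2))ᶜ
  swap
  · rw [Set.indicator_of_notMem hξ]; exact zero_le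
  rw [Set.indicator_of_mem hξ]
  by_cases hc : ∀ i, ξ i ∈ Set.Ioo (0 : ℝ) (1 / 2)
  swap
  · rw [logSingular_of_notMem hc, enorm_zero]; exact zero_le
  have h1 : 1 / 2 < ‖ξ‖ := by simpa using hξ
  have h2 : ‖ξ‖ ≤ d := (norm_le_of_mem_openCube hc).trans (by linarith)
  have hpos : 0 < ‖ξ‖ := by linarith
  have hmem : ξ ∈ {ξ : EuclideanSpace ℝ (Fin d) | 1 / 2 ≤ ‖ξ‖ ∧ ‖ξ‖ ≤ d} := ⟨h1.le, h2⟩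
  rw [sphereWeight, Set.indicator_of_mem hmem]
  rcases eq_or_ne (1 - ‖ξ‖) 0 with h0 | h0
  · rw [h0, abs_zero, ENNReal.ofReal_zero, ENNReal.zero_rpow_of_neg (by norm_num),
      ENNReal.mul_top]
    · exact le_top
    · have : 0 < (2 : ℝ) ^ ((d : ℝ) / 2) * (d : ℝ) ^ (1 / 2 : ℝ) := by positivity
      simpa using this
  have habs : 0 < |1 - ‖ξ‖| := abs_pos.2 h0
  rw [ENNReal.ofReal_rpow_of_pos habs, ← ENNReal.ofReal_mul (by positivity), ← ofReal_norm]
  refine ENNReal.ofReal_le_ofReal ((norm_logSingular_le ξ).trans ?_)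
  have h3 : ‖ξ‖ ^ (-(d : ℝ) / 2) ≤ (2 : ℝ) ^ ((d : ℝ) / 2) := by
    calc ‖ξ‖ ^ (-(d : ℝ) / 2) ≤ (1 / 2 : ℝ) ^ (-(d : ℝ) / 2) :=
          Real.rpow_le_rpow_of_nonpos (by norm_num) h1.le (by linarith)
      _ = _ := by
          rw [one_div, Real.inv_rpow (by norm_num), ← Real.rpow_neg (by norm_num)]
          congr 1
          ring
  have h4 : |Real.log ‖ξ‖| ^ (-(1 : ℝ) / 2) ≤
      (d : ℝ) ^ (1 / 2 : ℝ) * |1 - ‖ξ‖| ^ (-(1 / 2) : ℝ) := by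
    calc |Real.log ‖ξ‖| ^ (-(1 : ℝ) / 2) ≤ (|1 - ‖ξ‖| / d) ^ (-(1 : ℝ) / 2) :=
          Real.rpow_le_rpow_of_nonpos (by positivity) (abs_one_sub_div_le_abs_log hpos h2 hd1)
            (by norm_num)
      _ = _ := by
          have : (-(1 : ℝ) / 2) = -(1 / 2) := by ring
          rw [this, Real.div_rpow habs.le hd'.le, Real.rpow_neg hd'.le, div_inv_eq_mul, mul_comm]
  calc _ ≤ (2 : ℝ) ^ ((d : ℝ) / 2) * ((d : ℝ) ^ (1 / 2 : ℝ) * |1 - ‖ξ‖| ^ (-(1 / 2) : ℝ)) := by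
        gcongr
    _ = _ := by ring

/-- The function `g` is singular at the origin and, through the zero of the logarithm, on the unit
sphere, which meets the cube `(0, 1/2)^d` when `d > 4`. The two singularities are treated
separately. -/
theorem boxSum_logSingular_lt_top (hd : 0 < d) {s q : ℝ} (hs : 1 ≤ s) (hs2 : s < 2)
    (hq : 2 < q) : boxSum s q (fun ξ => ‖logSingular d ξ‖ₑ) < ∞ := by
  have hs0 : 0 < s := by linarith
  have hr : 1 ≤ q / s := by rw [le_div_iff₀ hs0]; linarith
  refine (boxSum_le_indicator_add hs0 (by linarith) (measurable_logSingular d).enorm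
    (Metric.isClosed_closedBall.measurableSet (s := Metric.closedBall 0 (1 / 2)))).trans_lt
    (ENNReal.mul_lt_top (two_rpow_ne_top _).lt_top (ENNReal.add_lt_top.2
      ⟨boxSum_logSingular_near_lt_top hd hs hs2 hq, ?_⟩))
  rcases (by omega : d = 1 ∨ 2 ≤ d) with rfl | hd2
  · -- in dimension one the support lies in the ball
    have h0 : ((Metric.closedBall (0 : EuclideanSpace ℝ (Fin 1)) (1 / 2))ᶜ.indicator
        fun ξ => ‖logSingular 1 ξ‖ₑ) = fun ξ => 0 * (0 : ℝ≥0∞) := by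
      ext ξ
      rw [zero_mul]
      by_cases hc : ∀ i, ξ i ∈ Set.Ioo (0 : ℝ) (1 / 2)
      · apply Set.indicator_of_notMem
        have := norm_le_of_mem_openCube hc
        simpa using this
      · simp [logSingular_of_notMem hc]
    rw [h0, boxSum_const_mul hs0 (by linarith) ENNReal.zero_ne_top (fun _ => 0),
      ENNReal.zero_rpow_of_pos (by linarith), zero_mul]
    exact ENNReal.zero_lt_top
  · refine (boxSum_mono hs0 (by linarith) (indicator_compl_logSingular_le hd)).trans_lt ?_
    rw [boxSum_const_mul hs0 (by linarith) ENNReal.ofReal_ne_top]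
    exact ENNReal.mul_lt_top (ENNReal.rpow_lt_top_of_nonneg (by linarith) ENNReal.ofReal_ne_top)
      (boxSum_sphereWeight_lt_top hs hs2 hq hd2)

theorem memLp_one_logSingular (hd : 0 < d) : MemLp (logSingular d) 1 volume := by
  refine ⟨(measurable_logSingular d).aestronglyMeasurable, ?_⟩
  have hD : MeasurableSet (Metric.closedBall (0 : EuclideanSpace ℝ (Fin d)) (1 / 2)) :=
    Metric.isClosed_closedBall.measurableSet
  rw [eLpNorm_one_eq_lintegral_enorm, ← lintegral_add_compl _ hD]
  refine ENNReal.add_lt_top.2 ⟨?_, ?_⟩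
  · have h := setLIntegral_closedBall_logSingular_le (d := d) le_rfl zero_lt_one
    simp only [ENNReal.rpow_one, pow_one] at h
    refine h.trans_lt (ENNReal.mul_lt_top (ballConst_ne_top hd zero_le_one (by norm_num)).lt_top
      (ENNReal.mul_lt_top ?_ (two_rpow_ne_top _).lt_top))
    simp
  · rw [← lintegral_indicator hD.compl]
    refine (lintegral_mono (indicator_compl_logSingular_le hd)).trans_lt ?_
    rw [lintegral_const_mul' _ _ ENNReal.ofReal_ne_top]
    exact ENNReal.mul_lt_top ENNReal.ofReal_lt_top
      (lintegral_sphereWeight_ne_top hd (by norm_num) (by norm_num)).lt_top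

/-! ### The function `g` is not square integrable -/

/-- The part of the dyadic annulus in the open positive orthant; for `n ≥ 2` it lies in the support
of `g`. -/
def orthantAnnulus (d n : ℕ) : Set (EuclideanSpace ℝ (Fin d)) :=
  annulus d n ∩ {ξ | ∀ i, 0 < ξ i}

theorem measurableSet_orthantAnnulus (d n : ℕ) : MeasurableSet (orthantAnnulus d n) := by
  refine (measurableSet_annulus d n).inter ?_
  have : {ξ : EuclideanSpace ℝ (Fin d) | ∀ i, 0 < ξ i} = ⋂ i, {ξ | 0 < ξ i} := by
    ext ξ; simp
  rw [this]
  exact MeasurableSet.iInter fun i => measurableSet_lt measurable_const (by fun_prop)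

theorem pairwise_disjoint_orthantAnnulus (d : ℕ) :
    Pairwise (Function.onFun Disjoint (orthantAnnulus d)) := by
  have key : ∀ m n : ℕ, m < n → Disjoint (orthantAnnulus d m) (orthantAnnulus d n) := by
    intro m n hmn
    rw [Set.disjoint_left]
    intro ξ hm hn
    have h1 : (1 / 2 : ℝ) ^ n ≤ (1 / 2) ^ (m + 1) :=
      pow_le_pow_of_le_one (by norm_num) (by norm_num) hmn
    have h2 := hm.1.1
    have h3 := hn.1.2
    linarith
  intro m n hmn
  rcases lt_or_gt_of_ne hmn with h | h
  · exact key m n h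
  · exact (key n m h).symm

theorem volume_orthantAnnulus (d n : ℕ) :
    volume (orthantAnnulus d n) = 2 ^ (-((n : ℝ) * d)) * volume (orthantAnnulus d 0) := by
  have h : orthantAnnulus d n =
      (fun ξ : EuclideanSpace ℝ (Fin d) => (2 : ℝ) ^ n • ξ) ⁻¹' orthantAnnulus d 0 := by
    ext ξ
    have h2 : (0 : ℝ) < 2 ^ n := by positivity
    have e1 : (1 / 2 : ℝ) ^ (0 + 1) < 2 ^ n * ‖ξ‖ ↔ (1 / 2 : ℝ) ^ (n + 1) < ‖ξ‖ := by
      rw [zero_add, pow_one, pow_succ, one_div, inv_pow, ← div_lt_iff₀' h2]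
      rw [show (2 : ℝ)⁻¹ / 2 ^ n = (2 ^ n)⁻¹ * 2⁻¹ by field_simp]
    have e2 : 2 ^ n * ‖ξ‖ ≤ (1 / 2 : ℝ) ^ 0 ↔ ‖ξ‖ ≤ (1 / 2 : ℝ) ^ n := by
      rw [pow_zero, one_div, inv_pow, ← le_div_iff₀' h2, one_div]
    simp only [orthantAnnulus, annulus, Set.mem_inter_iff, Set.mem_ofPred_eq, Set.mem_preimage,
      norm_smul, Real.norm_eq_abs, abs_of_pos h2, e1, e2, PiLp.smul_apply, smul_eq_mul,
      mul_pos_iff_of_pos_left h2]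
  rw [h, Measure.addHaar_preimage_smul _ (by positivity), finrank_euclideanSpace_fin,
    abs_of_pos (by positivity), ← inv_pow, ENNReal.ofReal_pow (by positivity), ← inv_pow,
    ← one_div, ofReal_half_pow, ← ENNReal.rpow_natCast, ← ENNReal.rpow_mul, neg_mul]

theorem volume_orthantAnnulus_zero_pos (hd : 0 < d) : 0 < volume (orthantAnnulus d 0) := by
  have hopen : IsOpen {ξ : EuclideanSpace ℝ (Fin d) | (1 / 2 < ‖ξ‖ ∧ ‖ξ‖ < 1) ∧ ∀ i, 0 < ξ i} := by
    have e : {ξ : EuclideanSpace ℝ (Fin d) | (1 / 2 < ‖ξ‖ ∧ ‖ξ‖ < 1) ∧ ∀ i, 0 < ξ i} =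
        ({ξ | 1 / 2 < ‖ξ‖} ∩ {ξ | ‖ξ‖ < 1}) ∩ ⋂ i, {ξ | 0 < ξ i} := by
      ext ξ; simp
    rw [e]
    refine ((isOpen_lt continuous_const continuous_norm).inter
      (isOpen_lt continuous_norm continuous_const)).inter (isOpen_iInter_of_finite fun i =>
        isOpen_lt continuous_const (by fun_prop))
  have hne : {ξ : EuclideanSpace ℝ (Fin d) |
      (1 / 2 < ‖ξ‖ ∧ ‖ξ‖ < 1) ∧ ∀ i, 0 < ξ i}.Nonempty := by
    set v : EuclideanSpace ℝ (Fin d) := WithLp.toLp 2 fun _ => 1 with hv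
    have hv0 : 0 < ‖v‖ := by
      rw [norm_pos_iff]
      intro h
      have := congrArg (fun x : EuclideanSpace ℝ (Fin d) => x ⟨0, hd⟩) h
      simp [hv] at this
    have hn : ‖(3 / 4 / ‖v‖) • v‖ = 3 / 4 := by
      rw [norm_smul, Real.norm_eq_abs, abs_of_pos (by positivity)]
      field_simp
    refine ⟨(3 / 4 / ‖v‖) • v, ⟨?_, ?_⟩, fun i => ?_⟩
    · rw [hn]; norm_num
    · rw [hn]; norm_num
    · have : ((3 / 4 / ‖v‖) • v) i = 3 / 4 / ‖v‖ := by simp [hv]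
      rw [this]; positivity
  refine (hopen.measure_pos volume hne).trans_le (measure_mono ?_)
  intro ξ hξ
  exact ⟨⟨by simpa using hξ.1.1, by simpa using hξ.1.2.le⟩, hξ.2⟩

/-- On the annulus `|ξ| ~ 2^{-m}` in the orthant, `g^2` is at least of order `2^{md} / m`. -/
theorem le_enorm_logSingular_sq {n : ℕ} {ξ : EuclideanSpace ℝ (Fin d)}
    (hξ : ξ ∈ orthantAnnulus d (n + 2)) :
    2 ^ (((n + 2 : ℕ) : ℝ) * d) * ENNReal.ofReal (((n + 3 : ℕ) : ℝ) * Real.log 2)⁻¹ ≤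
      ‖logSingular d ξ‖ₑ ^ (2 : ℝ) := by
  have hpos : 0 < ‖ξ‖ := lt_trans (by positivity) hξ.1.1
  have hle : ‖ξ‖ ≤ 1 / 4 := hξ.1.2.trans (by
    rw [pow_add]
    have : (1 / 2 : ℝ) ^ n ≤ 1 := pow_le_one₀ (by norm_num) (by norm_num)
    linarith)
  have hcube : ∀ i, ξ i ∈ Set.Ioo (0 : ℝ) (1 / 2) := fun i => by
    refine ⟨hξ.2 i, ?_⟩
    have h1 : ‖ξ i‖ ≤ ‖ξ‖ := PiLp.norm_apply_le ξ i
    rw [Real.norm_eq_abs, abs_of_pos (hξ.2 i)] at h1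
    linarith
  have hval : logSingular d ξ =
      ((‖ξ‖ ^ (-(d : ℝ) / 2) * |Real.log ‖ξ‖| ^ (-(1 : ℝ) / 2) : ℝ) : ℂ) :=
    Set.indicator_of_mem
      (s := {ξ : EuclideanSpace ℝ (Fin d) | ∀ i, ξ i ∈ Set.Ioo (0 : ℝ) (1 / 2)}) hcube _
  have hlog : 0 < |Real.log ‖ξ‖| := abs_pos.2 (Real.log_neg hpos (by linarith)).ne
  have hlog2 : |Real.log ‖ξ‖| ≤ ((n + 3 : ℕ) : ℝ) * Real.log 2 := by
    have h := Real.log_le_log (by positivity) hξ.1.1.le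
    rw [Real.log_pow, one_div, Real.log_inv] at h
    rw [abs_of_neg (Real.log_neg hpos (by linarith))]
    push_cast at h ⊢
    linarith
  have hsq : (‖ξ‖ ^ (-(d : ℝ) / 2) * |Real.log ‖ξ‖| ^ (-(1 : ℝ) / 2)) ^ (2 : ℝ) =
      ‖ξ‖ ^ (-(d : ℝ)) * |Real.log ‖ξ‖|⁻¹ := by
    rw [Real.mul_rpow (by positivity) (by positivity), ← Real.rpow_mul hpos.le,
      ← Real.rpow_mul hlog.le, ← Real.rpow_neg_one |Real.log ‖ξ‖|]
    congr 2 <;> ring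
  rw [hval, ← ofReal_norm, Complex.norm_real, Real.norm_eq_abs, abs_of_nonneg (by positivity),
    ENNReal.ofReal_rpow_of_nonneg (by positivity) (by norm_num), hsq,
    ENNReal.ofReal_mul (by positivity)]
  refine mul_le_mul' ?_ (ENNReal.ofReal_le_ofReal (inv_anti₀ hlog hlog2))
  rw [← ENNReal.ofReal_rpow_of_pos hpos, ENNReal.rpow_neg, ENNReal.rpow_mul,
    ← ENNReal.inv_rpow]
  refine ENNReal.rpow_le_rpow ?_ (Nat.cast_nonneg d)
  rw [← inv_inv ((2 : ℝ≥0∞) ^ ((n + 2 : ℕ) : ℝ)), ← ENNReal.rpow_neg, ← ofReal_half_pow]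
  exact ENNReal.inv_le_inv.2 (ENNReal.ofReal_le_ofReal hξ.1.2)

/-- Each annulus contributes at least a constant times `1 / m`, and the harmonic series diverges. -/
theorem lintegral_logSingular_sq (hd : 0 < d) : ∫⁻ ξ, ‖logSingular d ξ‖ₑ ^ (2 : ℝ) = ∞ := by
  set v := volume (orthantAnnulus d 0) with hv
  have hv0 : v ≠ 0 := (volume_orthantAnnulus_zero_pos hd).ne'
  have hharm : ∑' n : ℕ, ENNReal.ofReal (((n + 3 : ℕ) : ℝ) * Real.log 2)⁻¹ = ∞ := by
    by_contra h
    have hs := ENNReal.summable_toReal h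
    have hl2 : 0 < Real.log 2 := Real.log_pos (by norm_num)
    have h1 : ∀ n : ℕ, (ENNReal.ofReal (((n + 3 : ℕ) : ℝ) * Real.log 2)⁻¹).toReal =
        (Real.log 2)⁻¹ * (1 / ((n + 3 : ℕ) : ℝ)) := by
      intro n
      rw [ENNReal.toReal_ofReal (by positivity), mul_inv, one_div, mul_comm]
    simp only [h1] at hs
    have h2 := (summable_mul_left_iff (inv_ne_zero hl2.ne')).1 hs
    exact Real.not_summable_one_div_natCast
      ((summable_nat_add_iff 3 (f := fun n : ℕ => 1 / (n : ℝ))).1 h2)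
  rw [eq_top_iff]
  calc ∞ = ∑' n : ℕ, v * ENNReal.ofReal (((n + 3 : ℕ) : ℝ) * Real.log 2)⁻¹ := by
        rw [ENNReal.tsum_mul_left, hharm, ENNReal.mul_top hv0]
    _ ≤ ∑' n : ℕ, ∫⁻ ξ in orthantAnnulus d (n + 2), ‖logSingular d ξ‖ₑ ^ (2 : ℝ) := by
        refine ENNReal.tsum_le_tsum fun n => ?_
        refine le_trans (le_of_eq ?_) (setLIntegral_mono' (measurableSet_orthantAnnulus d (n + 2))
          fun ξ hξ => le_enorm_logSingular_sq hξ)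
        rw [setLIntegral_const, volume_orthantAnnulus, ← hv]
        have : (2 : ℝ≥0∞) ^ (((n + 2 : ℕ) : ℝ) * d) * 2 ^ (-(((n + 2 : ℕ) : ℝ) * d)) = 1 := by
          rw [← two_rpow_add, add_neg_cancel, ENNReal.rpow_zero]
        rw [mul_right_comm, ← mul_assoc, this, one_mul]
    _ = ∫⁻ ξ in ⋃ n, orthantAnnulus d (n + 2), ‖logSingular d ξ‖ₑ ^ (2 : ℝ) :=
        (lintegral_iUnion (s := fun n => orthantAnnulus d (n + 2))
          (fun n => measurableSet_orthantAnnulus d _)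
          (fun m n hmn => pairwise_disjoint_orthantAnnulus d (by simpa using hmn)) _).symm
    _ ≤ _ := setLIntegral_le_lintegral _ _

end LogSingular

/-! ### Strictness of the embedding of `L^2` -/

section Strictness

variable {d : ℕ}

theorem conjExponent_mem_Ioo {p : ℝ} (hp : 2 < p) : p.conjExponent ∈ Set.Ioo (1 : ℝ) 2 := by
  have hsp : p.conjExponent.HolderConjugate p :=
    (Real.HolderConjugate.conjExponent (by linarith)).symm
  refine ⟨hsp.lt, ?_⟩
  rw [Real.conjExponent, div_lt_iff₀ (by linarith)]
  linarith

theorem enorm_fourier (f : Lp ℂ 2 (volume : Measure (EuclideanSpace ℝ (Fin d)))) :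
    ‖(𝓕 f : Lp ℂ 2 (volume : Measure (EuclideanSpace ℝ (Fin d))))‖ₑ = ‖f‖ₑ := by
  rw [← ofReal_norm, ← ofReal_norm, Lp.norm_fourier_eq]

theorem exists_fxNorm_le (hd : 0 < d) {ψ : 𝓢(EuclideanSpace ℝ (Fin d), ℂ)}
    (hψ : IsUniformWindow ψ) {s q : ℝ} (hs : 1 ≤ s) (hs2 : s < 2) (hq : 2 < q) :
    ∃ C : ℝ≥0, ∀ f : Lp ℂ 2 (volume : Measure (EuclideanSpace ℝ (Fin d))),
      fxNorm ψ s q (f : 𝓢'(EuclideanSpace ℝ (Fin d), ℂ)) ≤ C * ‖f‖ₑ := by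
  obtain ⟨C, hC⟩ := exists_xNorm_le hd hψ hs hs2 hq
  refine ⟨C, fun f => ?_⟩
  rw [fxNorm, Lp.fourier_toTemperedDistribution_eq, ← enorm_fourier f]
  exact hC _

theorem toLp_logSingular_apply (hg : MemLp (logSingular d) 1 volume)
    (φ : 𝓢(EuclideanSpace ℝ (Fin d), ℂ)) :
    (hg.toLp (logSingular d) : 𝓢'(EuclideanSpace ℝ (Fin d), ℂ)) φ =
      ∫ ξ, φ ξ * logSingular d ξ := by
  rw [Lp.toTemperedDistribution_apply]
  apply integral_congr_ae
  filter_upwards [hg.coeFn_toLp] with ξ hξ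
  rw [hξ, smul_eq_mul]

theorem fxNorm_fourierInv_logSingular_lt_top (hd : 0 < d) {ψ : 𝓢(EuclideanSpace ℝ (Fin d), ℂ)}
    (hψ : IsUniformWindow ψ) {s q : ℝ} (hs : 1 ≤ s) (hs2 : s < 2) (hq : 2 < q)
    (hg : MemLp (logSingular d) 1 volume) :
    fxNorm ψ s q (𝓕⁻ (hg.toLp (logSingular d) : 𝓢'(EuclideanSpace ℝ (Fin d), ℂ))) < ∞ := by
  rw [fxNorm, FourierTransform.fourier_fourierInv_eq]
  refine (xNorm_le_boxSum hψ (A := ‖ψ.toBoundedContinuousFunction‖₊)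
    (fun ξ => ψ.toBoundedContinuousFunction.nnnorm_coe_le_nnnorm ξ) (by linarith) (by linarith)
    hg.1 (toLp_logSingular_apply hg)).trans_lt ?_
  exact ENNReal.mul_lt_top ENNReal.coe_lt_top
    (ENNReal.rpow_lt_top_of_nonneg (by positivity) (boxSum_logSingular_lt_top hd hs hs2 hq).ne)

/-- If `𝓕⁻ g` were in `L^2`, its Fourier transform `g` would be a square integrable function. -/
theorem fourierInv_logSingular_notMem_l2Space (hd : 0 < d)
    (hg : MemLp (logSingular d) 1 volume) :
    𝓕⁻ (hg.toLp (logSingular d) : 𝓢'(EuclideanSpace ℝ (Fin d), ℂ)) ∉ l2Space d := by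
  rintro ⟨h, hh⟩
  dsimp only at hh
  have h1 : ((𝓕 h : Lp ℂ 2 (volume : Measure (EuclideanSpace ℝ (Fin d)))) :
      𝓢'(EuclideanSpace ℝ (Fin d), ℂ)) = hg.toLp (logSingular d) := by
    rw [← Lp.fourier_toTemperedDistribution_eq, hh, FourierTransform.fourier_fourierInv_eq]
  set H : Lp ℂ 2 (volume : Measure (EuclideanSpace ℝ (Fin d))) := 𝓕 h with hH
  have hae : logSingular d =ᵐ[volume] H := by
    refine ae_eq_of_forall_schwartz (hg.locallyIntegrable le_rfl)
      ((Lp.memLp H).locallyIntegrable (by norm_num)) fun φ => ?_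
    rw [← toLp_logSingular_apply hg, ← h1, Lp.toTemperedDistribution_apply]
    rfl
  have h2 : eLpNorm (logSingular d) 2 volume < ∞ := by
    rw [eLpNorm_congr_ae hae]
    exact (Lp.memLp H).2
  rw [eLpNorm_lt_top_iff_lintegral_rpow_enorm_lt_top two_ne_zero ENNReal.ofNat_ne_top,
    ENNReal.toReal_ofNat, lintegral_logSingular_sq hd] at h2
  exact lt_irrefl _ h2

end Strictness

end ScaledModulation

theorem mainTheorem3 (d : ℕ) (hd : 0 < d) (ψ : 𝓢(EuclideanSpace ℝ (Fin d), ℂ))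
    (hψ : ScaledModulation.IsUniformWindow ψ) (p q : ℝ) (hp : 2 < p) (hq : 1 ≤ q) :
    (∀ f : 𝓢'(EuclideanSpace ℝ (Fin d), ℂ),
      ScaledModulation.modNorm ψ (ScaledModulation.weight d p) p q q f ≤
        ScaledModulation.fxNorm ψ p.conjExponent q f) ∧
    ScaledModulation.fxSpace ψ p.conjExponent q ⊆
      ScaledModulation.modSpace ψ (ScaledModulation.weight d p) p q q ∧
    (2 < q →
      (∃ C : ℝ≥0, ∀ f : Lp ℂ 2 (volume : Measure (EuclideanSpace ℝ (Fin d))),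
        ScaledModulation.fxNorm ψ p.conjExponent q (f : 𝓢'(EuclideanSpace ℝ (Fin d), ℂ)) ≤
          C * ‖f‖ₑ) ∧
      (∃ C : ℝ≥0, ∀ f : Lp ℂ 2 (volume : Measure (EuclideanSpace ℝ (Fin d))),
        ScaledModulation.modNorm ψ (ScaledModulation.weight d p) p q q
          (f : 𝓢'(EuclideanSpace ℝ (Fin d), ℂ)) ≤ C * ‖f‖ₑ) ∧
      ScaledModulation.l2Space d ⊂
        ScaledModulation.modSpace ψ (ScaledModulation.weight d p) p q q ∧
      ∃ hg : MemLp (ScaledModulation.logSingular d) 1 volume,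
        𝓕⁻ (hg.toLp (ScaledModulation.logSingular d) : 𝓢'(EuclideanSpace ℝ (Fin d), ℂ)) ∈
          ScaledModulation.modSpace ψ (ScaledModulation.weight d p) p q q \
            ScaledModulation.l2Space d) := by
  have hle := ScaledModulation.modNorm_le_fxNorm ψ hp hq
  obtain ⟨hs1, hs2⟩ := ScaledModulation.conjExponent_mem_Ioo hp
  refine ⟨hle, fun f hf => (hle f).trans_lt hf, fun hq2 => ?_⟩
  obtain ⟨C, hC⟩ := ScaledModulation.exists_fxNorm_le hd hψ hs1.le hs2 hq2
  have hg := ScaledModulation.memLp_one_logSingular hd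
  have hmem : 𝓕⁻ (hg.toLp (ScaledModulation.logSingular d) :
      𝓢'(EuclideanSpace ℝ (Fin d), ℂ)) ∈
        ScaledModulation.modSpace ψ (ScaledModulation.weight d p) p q q \
          ScaledModulation.l2Space d :=
    ⟨(hle _).trans_lt (ScaledModulation.fxNorm_fourierInv_logSingular_lt_top hd hψ hs1.le hs2
      hq2 hg), ScaledModulation.fourierInv_logSingular_notMem_l2Space hd hg⟩
  have hsub : ScaledModulation.l2Space d ⊆
      ScaledModulation.modSpace ψ (ScaledModulation.weight d p) p q q := by
    rintro _ ⟨f, rfl⟩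
    exact ((hle _).trans (hC f)).trans_lt (ENNReal.mul_lt_top ENNReal.coe_lt_top enorm_lt_top)
  exact ⟨⟨C, hC⟩, ⟨C, fun f => (hle _).trans (hC f)⟩, ⟨hsub, fun h => hmem.2 (h hmem.1)⟩, hg, hmem⟩
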